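/- Let $\mathcal H$ be a real Hilbert space. Let $f:\mathcal H\to\mathbb R$ be convex, twice continuously differentiable and bounded below, and suppose that $\nabla f$ is Lipschitz continuous on the bounded subsets of $\mathcal H$. Let $\phi:\mathcal H\to\mathbb R_+$ be a damping potential, that is: $\phi$ is nonnegative, convex and continuous; $\phi(0)=0=\min_{\mathcal H}\phi$; and for every $R>0$, $\sup_{\|u\|\le R}\|(\partial\phi)^0(u)\|<+\infty$, where $(\partial\phi)^0(u)$ denotes the element of minimal norm of the convex subdifferential $\partial\phi(u)$. Let $\beta\ge 0$. Consider the differential inclusion $$\text{(ADIGE-VGH)}\qquad \ddot x(t)+\partial\phi\big(\dot x(t)+\beta\nabla f(x(t))\big)+\beta\nabla^2 f(x(t))\dot x(t)+\nabla f(x(t))\ni 0 .$$ A strong global solution of (ADIGE-VGH) is a function $x\in\mathcal C^1([0,+\infty[;\mathcal H)$ such that, for every $T>0$, $\dot x$ is Lipschitz continuous on $(0,T)$ and $\ddot x\in L^\infty(0,T;\mathcal H)$, and such that for almost every $t>0$ the function $\dot x$ is differentiable at $t$ and the inclusion holds at $t$. Then, for any Cauchy data $(x_0,x_1)\in\mathcal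 H\times\mathcal H$, there exists a unique strong global solution $x:[0,+\infty[\to\mathcal H$ of (ADIGE-VGH) satisfying $x(0)=x_0$ and $\dot x(0)=x_1$. -/

import Mathlib

open Set MeasureTheory Topology
open scoped NNReal ENNReal

namespace ADIGE

variable {H : Type*} [NormedAddCommGroup H] [InnerProductSpace ℝ H]

/-- The convex subdifferential `∂φ(u)` of a real-valued function on a real Hilbert space. -/
def subdifferential (φ : H → ℝ) (u : H) : Set H :=
  {p | ∀ w : H, φ u + inner ℝ p (w - u) ≤ φ w}

/-- `p = (∂φ)⁰(u)`: `p` is an element of minimal norm of `∂φ(u)`. -/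
def IsMinimalSection (φ : H → ℝ) (u p : H) : Prop :=
  p ∈ subdifferential φ u ∧ ∀ q ∈ subdifferential φ u, ‖p‖ ≤ ‖q‖

/-- Damping potentials: nonnegative convex continuous functions with `φ 0 = 0 = min φ`, for which
the minimal section of the subdifferential is bounded on bounded sets. -/
structure IsDampingPotential (φ : H → ℝ) : Prop where
  nonneg : ∀ u, 0 ≤ φ u
  convex : ConvexOn ℝ univ φ
  continuous : Continuous φ
  map_zero : φ 0 = 0
  bounded_minimalSection :
    ∀ R : ℝ, 0 < R → ∃ M : ℝ, ∀ u p : H, ‖u‖ ≤ R → IsMinimalSection φ u p → ‖p‖ ≤ M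

/-- The minimal section is well defined: for `φ` convex and continuous, every `∂φ(u)` has exactly
one element of minimal norm. -/
theorem existsUnique_isMinimalSection [CompleteSpace H] {φ : H → ℝ} (hc : ConvexOn ℝ univ φ)
    (hcont : Continuous φ) (u : H) : ∃! p, IsMinimalSection φ u p := by
  have hne : (subdifferential φ u).Nonempty := by
    have ho : IsOpen {z : H × ℝ | φ z.1 < z.2} :=
      isOpen_lt (hcont.comp continuous_fst) continuous_snd
    have hconv : Convex ℝ {z : H × ℝ | φ z.1 < z.2} := by
      have := hc.convex_strict_epigraph
      simpa using this
    obtain ⟨g, hg⟩ := geometric_hahn_banach_open_point hconv ho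
      (x := (u, φ u)) (by simp)
    have hsplit : ∀ (x : H) (r : ℝ), g (x, r) = g (x, 0) + r * g (0, 1) := by
      intro x r
      have : ((x, r) : H × ℝ) = (x, 0) + r • (0, 1) := by simp
      rw [this, map_add, map_smul, smul_eq_mul]
    set c := g (0, 1) with hcdef
    have hcneg : c < 0 := by
      have := hg (u, φ u + 1) (by simp)
      rw [hsplit u (φ u + 1), hsplit u (φ u)] at this
      linarith
    let l : StrongDual ℝ H := g.comp (ContinuousLinearMap.inl ℝ H ℝ)
    have hc0 : c ≠ 0 := hcneg.ne
    have hl : ∀ x, l x = g (x, 0) := fun x => by simp [l]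
    refine ⟨(InnerProductSpace.toDual ℝ H).symm ((-c⁻¹) • l), fun w => ?_⟩
    rw [InnerProductSpace.toDual_symm_apply]
    have hle : l w + φ w * c ≤ l u + φ u * c := by
      refine le_of_forall_pos_lt_add fun ε hε => ?_
      have h1 := hg (w, φ w + ε / (-c)) (by
        have : 0 < ε / (-c) := div_pos hε (by linarith)
        change φ w < φ w + ε / (-c)
        linarith)
      rw [hsplit w _, hsplit u (φ u), ← hl, ← hl, add_mul] at h1
      have h2 : ε / (-c) * c = -ε := by
        rw [div_neg, neg_mul, div_mul_cancel₀ _ hc0]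
      linarith
    have h3 : ((-c⁻¹) • l) (w - u) = (-c⁻¹) * (l w - l u) := by
      rw [smul_apply, map_sub, smul_eq_mul]
    rw [h3]
    have h4 : 0 < -c⁻¹ := by simpa using inv_lt_zero.mpr hcneg
    have h5 : (-c⁻¹) * (l w - l u) ≤ (-c⁻¹) * ((φ u - φ w) * c) :=
      mul_le_mul_of_nonneg_left (by linarith) h4.le
    have h6 : (-c⁻¹) * ((φ u - φ w) * c) = φ w - φ u := by
      have : c⁻¹ * c = 1 := inv_mul_cancel₀ hc0
      linear_combination (φ w - φ u) * this
    linarith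
  have hclosed : IsClosed (subdifferential φ u) := by
    have : subdifferential φ u = ⋂ w : H, {p | φ u + inner ℝ p (w - u) ≤ φ w} := by
      ext p; simp [subdifferential]
    rw [this]
    exact isClosed_iInter fun w => isClosed_le (by fun_prop) continuous_const
  have hcx : Convex ℝ (subdifferential φ u) := by
    intro p hp q hq a b ha hb hab w
    have h1 := mul_le_mul_of_nonneg_left (hp w) ha
    have h2 := mul_le_mul_of_nonneg_left (hq w) hb
    rw [inner_add_left, real_inner_smul_left, real_inner_smul_left]
    have h3 : a = 1 - b := by linarith
    subst h3
    nlinarith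
  obtain ⟨p, hp, hpm⟩ := exists_norm_eq_iInf_of_complete_convex hne hclosed.isComplete hcx (0 : H)
  have hmin := (norm_eq_iInf_iff_real_inner_le_zero hcx hp).1 hpm
  have hle : ∀ q ∈ subdifferential φ u, ‖p‖ ^ 2 ≤ inner ℝ p q := by
    intro q hq
    have := hmin q hq
    rw [zero_sub, inner_neg_left, inner_sub_right, real_inner_self_eq_norm_sq] at this
    linarith
  refine ⟨p, ⟨hp, fun q hq => ?_⟩, fun q hq => ?_⟩
  · have h1 := (hle q hq).trans (real_inner_le_norm p q)
    nlinarith [norm_nonneg p, norm_nonneg q]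
  · have h1 := hle q hq.1
    have h2 := hq.2 p hp
    have h3 : ‖q - p‖ ^ 2 = ‖q‖ ^ 2 - 2 * inner ℝ q p + ‖p‖ ^ 2 := norm_sub_sq_real q p
    rw [real_inner_comm] at h1
    have h4 : ‖q - p‖ ^ 2 ≤ 0 := by nlinarith [norm_nonneg p, norm_nonneg q]
    have h5 : ‖q - p‖ = 0 := by nlinarith [norm_nonneg (q - p)]
    exact sub_eq_zero.1 (norm_eq_zero.1 h5)

/-- Lipschitz continuity on the bounded subsets of the space. -/
def LipschitzOnBounded (F : H → H) : Prop :=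
  ∀ s : Set H, Bornology.IsBounded s → ∃ K : ℝ≥0, LipschitzOnWith K F s

/-- The Hessian `∇²f(x)` as a continuous linear operator. -/
noncomputable def hessian [CompleteSpace H] (f : H → ℝ) (x : H) : H →L[ℝ] H :=
  fderiv ℝ (gradient f) x

/-- The velocity `ẋ` of a trajectory defined on `[0, +∞)` (one-sided derivative at `0`).
Trajectories are represented by functions on `ℝ`; values at negative times play no role. -/
noncomputable def velocity (x : ℝ → H) (t : ℝ) : H :=
  derivWithin x (Ici 0) t

/-- The acceleration `ẍ`; it is only used at times `t > 0`. -/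
noncomputable def acceleration (x : ℝ → H) (t : ℝ) : H :=
  deriv (velocity x) t

/-- Strong global solutions on `[0, +∞)` of
`ẍ + ∂φ(ẋ + β ∇f(x)) + β ∇²f(x) ẋ + ∇f(x) ∋ 0`. -/
structure IsStrongGlobalSolution [CompleteSpace H] (f φ : H → ℝ) (β : ℝ) (x : ℝ → H) :
    Prop where
  contDiffOn : ContDiffOn ℝ 1 x (Ici 0)
  lipschitz_velocity : ∀ T : ℝ, 0 < T → ∃ K : ℝ≥0, LipschitzOnWith K (velocity x) (Ioo 0 T)
  memLp_acceleration : ∀ T : ℝ, 0 < T → MemLp (acceleration x) ∞ (volume.restrict (Ioo 0 T))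
  inclusion : ∀ᵐ t ∂(volume.restrict (Ioi (0 : ℝ))),
    DifferentiableAt ℝ (velocity x) t ∧
    ∃ p ∈ subdifferential φ (velocity x t + β • gradient f (x t)),
      acceleration x t + p + β • hessian f (x t) (velocity x t) + gradient f (x t) = 0

end ADIGE

/-! With `v = ẋ + β∇f(x)` the Hessian term is absorbed into `v̇`, and the inclusion becomes the
first-order system `ẋ = v - β∇f(x)`, `v̇ ∈ -∂φ(v) - ∇f(x)`. This is a Lipschitz-on-bounded-sets
perturbation of a monotone dynamics, so it is one-sided Lipschitz on bounded sets.

Existence: replace `∂φ` by its minimal section and run explicit Euler. The energy `f(x) + ‖v‖²/2`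
grows by at most `O(h²)` per step, which confines the nodes to a bounded set
(`PhaseData.exists_eulerBound`). There the one-sided Lipschitz bound makes polygons of steps `h` and
`k` differ by `O(√(h + k))` (`EulerBound.norm_sub_sq_le`), so they converge locally uniformly to a
Lipschitz curve, which is differentiable almost everywhere because its values lie in a Hilbert space
(`ae_differentiableAt_of_lipschitzWith`). The field may be discontinuous, so the equation does not
pass to the limit directly; the subgradient inequality does, because it bounds the field tested
against `a - w` by a continuous function (`IsEulerLimit.inner_deriv_le`). Varying the test point
recovers the inclusion.

Uniqueness: monotonicity of `∂φ` and Grönwall applied to `‖x - y‖² + ‖v - w‖²`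
(`IsStrongGlobalSolution.eqOn`). -/

namespace ADIGE

/-! ### Almost everywhere differentiability of Lipschitz curves in a Hilbert space. -/

section RadonNikodym

open Filter

variable {H : Type*} [NormedAddCommGroup H] [InnerProductSpace ℝ H]

theorem norm_sub_starProjection_sq (U : Submodule ℝ H) [U.HasOrthogonalProjection] (x : H) :
    ‖x - U.starProjection x‖ ^ 2 = ‖x‖ ^ 2 - ‖U.starProjection x‖ ^ 2 := by
  have h := U.norm_sq_eq_add_norm_sq_starProjection x
  rw [Submodule.starProjection_orthogonal_val] at h
  linarith

/-- Projections of a bounded compatible family along an increasing sequence of subspaces form a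
Cauchy sequence. -/
theorem cauchySeq_of_starProjection_eq (U : ℕ → Submodule ℝ H)
    [∀ n, (U n).HasOrthogonalProjection] {g : ℕ → H} {K : ℝ}
    (hg : ∀ n m, n ≤ m → (U n).starProjection (g m) = g n) (hK : ∀ n, ‖g n‖ ≤ K) :
    CauchySeq g := by
  -- By Pythagoras, squared distances are increments of the monotone bounded real sequence `‖g n‖²`.
  have key : ∀ n m, n ≤ m → ‖g m - g n‖ ^ 2 = ‖g m‖ ^ 2 - ‖g n‖ ^ 2 := fun n m h => by
    have := norm_sub_starProjection_sq (U n) (g m)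
    rwa [hg n m h] at this
  have hmono : Monotone fun n => ‖g n‖ ^ 2 := fun n m h => by
    have := key n m h
    have := sq_nonneg ‖g m - g n‖
    simp only
    linarith
  have hbdd : BddAbove (range fun n => ‖g n‖ ^ 2) := by
    refine ⟨K ^ 2, ?_⟩
    rintro _ ⟨n, rfl⟩
    exact pow_le_pow_left₀ (norm_nonneg _) (hK n) 2
  have hc := (tendsto_atTop_ciSup hmono hbdd).cauchySeq
  rw [Metric.cauchySeq_iff'] at hc ⊢
  intro ε hε
  obtain ⟨N, hN⟩ := hc (ε ^ 2) (by positivity)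
  refine ⟨N, fun n hn => ?_⟩
  have h1 := hN n hn
  rw [Real.dist_eq] at h1
  have h2 := lt_of_abs_lt h1
  rw [← key N n hn] at h2
  rw [dist_eq_norm]
  exact lt_of_pow_lt_pow_left₀ 2 hε.le h2

variable [CompleteSpace H]

/-- The fundamental theorem of calculus for a Lipschitz curve which is almost everywhere
differentiable. -/
theorem integral_deriv_eq_sub_of_lipschitzWith {v : ℝ → H} {K : ℝ≥0} (hv : LipschitzWith K v)
    (hd : ∀ᵐ t, DifferentiableAt ℝ v t) (a b : ℝ) : ∫ t in a..b, deriv v t = v b - v a := by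
  have hli : LocallyIntegrable (deriv v) volume := by
    have : MemLp (deriv v) ∞ volume :=
      memLp_top_of_bound (aestronglyMeasurable_deriv v _) K
        (Eventually.of_forall fun t => norm_deriv_le_of_lipschitz hv)
    exact this.locallyIntegrable le_top
  have hint : ∀ c d, IntervalIntegrable (deriv v) volume c d := fun c d =>
    (hli.integrableOn_isCompact isCompact_uIcc).intervalIntegrable
  have hIlip : LipschitzWith K (fun t => ∫ s in a..t, deriv v s) := by
    refine LipschitzWith.of_dist_le_mul fun s t => ?_
    rw [dist_eq_norm, intervalIntegral.integral_interval_sub_left (hint _ _) (hint _ _),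
      Real.dist_eq]
    exact intervalIntegral.norm_integral_le_of_norm_le_const fun r _ =>
      norm_deriv_le_of_lipschitz hv
  have hac : AbsolutelyContinuousOnInterval (fun t => v t - ∫ s in a..t, deriv v s) a b :=
    (hv.lipschitzOnWith (s := uIcc a b)).absolutelyContinuousOnInterval.sub
      (hIlip.lipschitzOnWith (s := uIcc a b)).absolutelyContinuousOnInterval
  obtain ⟨C, hC⟩ := hac.const_of_ae_hasDerivAt_zero (by
    filter_upwards [hd, LocallyIntegrable.ae_hasDerivAt_integral hli] with t h1 h2 _
    have h3 := h1.hasDerivAt.sub (h2 a)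
    rw [sub_self] at h3
    exact h3)
  have h1 := hC a (by simp)
  have h2 := hC b (by simp)
  simp only [intervalIntegral.integral_same, sub_zero] at h1
  rw [h1, ← h2]
  abel

/-- A Lipschitz curve in a Hilbert space is almost everywhere differentiable. -/
theorem ae_differentiableAt_of_lipschitzWith {v : ℝ → H} {K : ℝ≥0} (hv : LipschitzWith K v) :
    ∀ᵐ t, DifferentiableAt ℝ v t := by
  -- Spans of the values at finitely many times from a dense sequence: the projected curves live in
  -- finite dimension, where Rademacher applies, and the whole curve lies in the closure of the
  -- union of the spans, even if `H` is not separable.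
  let U : ℕ → Submodule ℝ H := fun n =>
    Submodule.span ℝ ((fun i => v (TopologicalSpace.denseSeq ℝ i)) '' Iio n)
  have hfin : ∀ n, FiniteDimensional ℝ (U n) := fun n =>
    FiniteDimensional.span_of_finite ℝ ((finite_Iio n).image _)
  have hUmono : Monotone U := fun n m h =>
    Submodule.span_mono (image_mono (Iio_subset_Iio h))
  let w : ℕ → ℝ → H := fun n t => (U n).starProjection (v t)
  have hwlip : ∀ n, LipschitzWith K (w n) := fun n => by
    have h1 : LipschitzWith 1 ((U n).starProjection : H → H) := by
      refine LipschitzWith.of_dist_le_mul fun x y => ?_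
      rw [dist_eq_norm, dist_eq_norm, ← map_sub, NNReal.coe_one, one_mul]
      exact (U n).norm_starProjection_apply_le _
    rw [← one_mul K]
    exact h1.comp hv
  have hwd : ∀ n, ∀ᵐ t, DifferentiableAt ℝ (w n) t := fun n => by
    have h1 : LipschitzWith 1 ((U n).orthogonalProjectionOnto : H → U n) := by
      refine LipschitzWith.of_dist_le_mul fun x y => ?_
      rw [dist_eq_norm, dist_eq_norm, ← map_sub, NNReal.coe_one, one_mul]
      exact (U n).norm_starProjection_apply_le _
    filter_upwards [(h1.comp hv).ae_differentiableAt_real] with t ht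
    exact (U n).subtypeL.differentiableAt.comp t ht
  have hlim : ∀ᵐ t, ∃ l, Tendsto (fun n => deriv (w n) t) atTop (𝓝 l) := by
    filter_upwards [ae_all_iff.2 hwd] with t ht
    refine cauchySeq_tendsto_of_complete (cauchySeq_of_starProjection_eq U (K := K) ?_ ?_)
    · intro n m hnm
      have h1 : w n = fun s => (U n).starProjection (w m s) := by
        funext s
        exact (DFunLike.congr_fun
          (Submodule.starProjection_comp_starProjection_of_le (hUmono hnm)) (v s)).symm
      rw [h1]
      exact (((U n).starProjection.hasFDerivAt.comp_hasDerivAt t (ht m).hasDerivAt).deriv).symm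
    · exact fun n => norm_deriv_le_of_lipschitz (hwlip n)
  obtain ⟨g, hgm, hg⟩ := exists_stronglyMeasurable_limit_of_tendsto_ae
    (fun n => aestronglyMeasurable_deriv (w n) volume) hlim
  have hgK : ∀ᵐ t, ‖g t‖ ≤ K := by
    filter_upwards [hg] with t ht
    exact le_of_tendsto ht.norm (Eventually.of_forall fun n =>
      norm_deriv_le_of_lipschitz (hwlip n))
  have hli : LocallyIntegrable g volume :=
    (memLp_top_of_bound hgm.aestronglyMeasurable K hgK).locallyIntegrable le_top
  have hwt : ∀ t, Tendsto (fun n => w n t) atTop (𝓝 (v t)) := fun t => by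
    have h1 := Submodule.starProjection_tendsto_closure_iSup U hUmono (v t)
    have h2 : v t ∈ (⨆ i, U i).topologicalClosure := by
      have h3 : v t ∈ closure (v '' range (TopologicalSpace.denseSeq ℝ)) :=
        image_closure_subset_closure_image hv.continuous
          ⟨t, (TopologicalSpace.denseRange_denseSeq ℝ) t, rfl⟩
      refine closure_mono ?_ h3
      rintro _ ⟨_, ⟨i, rfl⟩, rfl⟩
      exact Submodule.mem_iSup_of_mem (i + 1)
        (Submodule.subset_span ⟨i, Nat.lt_succ_self i, rfl⟩)
    rwa [Submodule.starProjection_eq_self_iff.2 h2] at h1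
  -- Dominated convergence (all derivatives are bounded by `K`) shows that `v` is a primitive of the
  -- limit `g`; Lebesgue differentiation then concludes.
  have hftc : ∀ t, ∫ s in (0 : ℝ)..t, g s = v t - v 0 := fun t => by
    have h1 : Tendsto (fun n => ∫ s in (0 : ℝ)..t, deriv (w n) s) atTop
        (𝓝 (∫ s in (0 : ℝ)..t, g s)) := by
      refine intervalIntegral.tendsto_integral_filter_of_dominated_convergence (fun _ => (K : ℝ))
        (Eventually.of_forall fun n => aestronglyMeasurable_deriv _ _)
        (Eventually.of_forall fun n => Eventually.of_forall fun s _ =>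
          norm_deriv_le_of_lipschitz (hwlip n)) intervalIntegrable_const ?_
      filter_upwards [hg] with s hs _ using hs
    refine tendsto_nhds_unique h1 ?_
    simp only [fun n => integral_deriv_eq_sub_of_lipschitzWith (hwlip n) (hwd n) 0 t]
    exact (hwt t).sub (hwt 0)
  have hveq : v = fun t => (∫ s in (0 : ℝ)..t, g s) + v 0 := by
    funext t
    rw [hftc]
    abel
  filter_upwards [LocallyIntegrable.ae_hasDerivAt_integral hli] with t ht
  rw [hveq]
  exact ((ht 0).add_const _).differentiableAt

/-- A curve in a Hilbert space which is Lipschitz on a compact interval is almost everywhere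
differentiable on its interior. -/
theorem ae_differentiableAt_of_lipschitzOnWith {v : ℝ → H} {K : ℝ≥0} {a b : ℝ} (hab : a ≤ b)
    (hv : LipschitzOnWith K v (Icc a b)) : ∀ᵐ t, t ∈ Ioo a b → DifferentiableAt ℝ v t := by
  have h1 : LipschitzWith K (fun t => v (projIcc a b hab t)) := by
    have h2 : LipschitzWith 1 (projIcc a b hab) := LipschitzWith.projIcc hab
    rw [← mul_one K]
    exact hv.to_restrict.comp h2
  filter_upwards [ae_differentiableAt_of_lipschitzWith h1] with t ht htab
  refine ht.congr_of_eventuallyEq ?_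
  filter_upwards [Ioo_mem_nhds htab.1 htab.2] with s hs
  rw [projIcc_of_mem hab (Ioo_subset_Icc_self hs)]

end RadonNikodym

/-! ### Explicit Euler polygons for a one-sided Lipschitz field. -/

section Euler

open Filter

variable {E : Type*} [NormedAddCommGroup E] [InnerProductSpace ℝ E]

/-- The nodes of the explicit Euler scheme for `z' = F z` with step `h`. -/
def eulerNode (F : E → E) (h : ℝ) (z₀ : E) : ℕ → E
  | 0 => z₀
  | n + 1 => eulerNode F h z₀ n + h • F (eulerNode F h z₀ n)

/-- The last node of the Euler scheme reached at time `t`. -/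
noncomputable def eulerStep (F : E → E) (h : ℝ) (z₀ : E) (t : ℝ) : E :=
  eulerNode F h z₀ ⌊t / h⌋₊

/-- The polygonal interpolation of the explicit Euler scheme. -/
noncomputable def eulerPath (F : E → E) (h : ℝ) (z₀ : E) (t : ℝ) : E :=
  eulerStep F h z₀ t + (t - ⌊t / h⌋₊ * h) • F (eulerStep F h z₀ t)

theorem eulerPath_zero (F : E → E) (h : ℝ) (z₀ : E) : eulerPath F h z₀ 0 = z₀ := by
  simp [eulerPath, eulerStep, eulerNode]

theorem eulerPath_eq_of_mem_Icc (F : E → E) {h : ℝ} (hh : 0 < h) (z₀ : E) {n : ℕ} {t : ℝ}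
    (ht : t ∈ Icc (n * h) ((n + 1) * h)) :
    eulerPath F h z₀ t = eulerNode F h z₀ n + (t - n * h) • F (eulerNode F h z₀ n) := by
  have ht0 : 0 ≤ t := le_trans (by positivity) ht.1
  rcases ht.2.lt_or_eq with hlt | heq
  · have : ⌊t / h⌋₊ = n := by
      rw [Nat.floor_eq_iff (by positivity), le_div_iff₀ hh, div_lt_iff₀ hh]
      exact ⟨ht.1, hlt⟩
    rw [eulerPath, eulerStep, this]
  -- At the right endpoint the floor has already jumped, but the next node is by construction the
  -- end of the `n`-th segment.
  · have : ⌊t / h⌋₊ = n + 1 := by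
      rw [heq, mul_div_cancel_right₀ _ hh.ne']
      exact_mod_cast Nat.floor_natCast (R := ℝ) (n + 1)
    rw [eulerPath, eulerStep, this, heq, eulerNode]
    push_cast
    rw [sub_self, zero_smul, add_zero]
    congr 2
    ring

theorem floor_div_mul_le {h t : ℝ} (hh : 0 < h) (ht : 0 ≤ t) : ⌊t / h⌋₊ * h ≤ t := by
  rw [← le_div_iff₀ hh]
  exact Nat.floor_le (by positivity)

theorem lt_floor_div_add_one_mul {h : ℝ} (hh : 0 < h) (t : ℝ) : t < (⌊t / h⌋₊ + 1) * h := by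
  rw [← div_lt_iff₀ hh]
  exact Nat.lt_floor_add_one _

theorem hasDerivAt_affine (a b : E) (c t : ℝ) :
    HasDerivAt (fun s : ℝ => a + (s - c) • b) b t := by
  simpa using (((hasDerivAt_id t).sub_const c).smul_const b).const_add a

theorem hasDerivWithinAt_eulerPath (F : E → E) {h : ℝ} (hh : 0 < h) (z₀ : E) {t : ℝ}
    (ht : 0 ≤ t) :
    HasDerivWithinAt (eulerPath F h z₀) (F (eulerStep F h z₀ t)) (Ici t) t := by
  have h1 := floor_div_mul_le hh ht
  have h2 := lt_floor_div_add_one_mul hh t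
  refine (hasDerivAt_affine (eulerStep F h z₀ t) (F (eulerStep F h z₀ t))
    (⌊t / h⌋₊ * h) t).hasDerivWithinAt.congr_of_eventuallyEq ?_ rfl
  filter_upwards [Ico_mem_nhdsGE h2] with s hs
  exact eulerPath_eq_of_mem_Icc F hh z₀ ⟨h1.trans hs.1, hs.2.le⟩

theorem continuousOn_eulerPath (F : E → E) {h : ℝ} (hh : 0 < h) (z₀ : E) :
    ContinuousOn (eulerPath F h z₀) (Ici 0) := by
  intro t ht
  have ht' : 0 ≤ t := ht
  have hr := (hasDerivWithinAt_eulerPath F hh z₀ ht').continuousWithinAt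
  rcases ht'.eq_or_lt with rfl | hpos
  · exact hr
  refine ContinuousAt.continuousWithinAt (continuousAt_iff_continuous_left_right.2 ⟨?_, hr⟩)
  -- For left continuity the segment must contain times before `t`, so `n` comes from the ceiling
  -- instead of the floor.
  obtain ⟨n, hn⟩ : ∃ n : ℕ, t / h ≤ n + 1 ∧ (n : ℝ) < t / h := by
    have hc : 0 < ⌈t / h⌉₊ := Nat.ceil_pos.2 (by positivity)
    obtain ⟨n, hn⟩ := Nat.exists_eq_succ_of_ne_zero hc.ne'
    refine ⟨n, ?_, ?_⟩
    · have := Nat.le_ceil (t / h)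
      rw [hn] at this
      exact_mod_cast this
    · exact Nat.lt_ceil.1 (by rw [hn]; exact n.lt_succ_self)
  rw [div_le_iff₀ hh, lt_div_iff₀ hh] at hn
  refine ((hasDerivAt_affine (eulerNode F h z₀ n) (F (eulerNode F h z₀ n))
    (n * h) t).continuousAt.continuousWithinAt).congr_of_eventuallyEq ?_
      (eulerPath_eq_of_mem_Icc F hh z₀ ⟨hn.2.le, hn.1⟩)
  filter_upwards [Ioc_mem_nhdsLE hn.2] with s hs
  exact eulerPath_eq_of_mem_Icc F hh z₀ ⟨hs.1.le, hs.2.trans hn.1⟩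

theorem norm_eulerPath_sub_eulerStep_le (F : E → E) {h : ℝ} (hh : 0 < h) (z₀ : E) {t : ℝ}
    (ht : 0 ≤ t) : ‖eulerPath F h z₀ t - eulerStep F h z₀ t‖ ≤ h * ‖F (eulerStep F h z₀ t)‖ := by
  have h1 := floor_div_mul_le hh ht
  have h2 := lt_floor_div_add_one_mul hh t
  rw [eulerPath, add_sub_cancel_left, norm_smul, Real.norm_eq_abs, abs_of_nonneg (by linarith)]
  gcongr
  linarith

/-- The data controlling the Euler scheme on `[0, T]`: for small steps the nodes stay in a region
`B` where the field is bounded and one-sided Lipschitz. -/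
structure EulerBound (F : E → E) (z₀ : E) (T h₀ M L : ℝ) (B : Set E) : Prop where
  step_pos : 0 < h₀
  nonneg : 0 ≤ L
  mem : ∀ h : ℝ, 0 < h → h ≤ h₀ → ∀ n : ℕ, n * h ≤ T → eulerNode F h z₀ n ∈ B
  bound : ∀ a ∈ B, ‖F a‖ ≤ M
  lipschitz : ∀ a ∈ B, ∀ b ∈ B, inner ℝ (F a - F b) (a - b) ≤ L * ‖a - b‖ ^ 2

namespace EulerBound

variable {F : E → E} {z₀ : E} {T h₀ M L : ℝ} {B : Set E}

theorem bound_nonneg (hB : EulerBound F z₀ T h₀ M L B) (hT : 0 ≤ T) : 0 ≤ M :=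
  (norm_nonneg _).trans (hB.bound _ (hB.mem h₀ hB.step_pos le_rfl 0 (by simpa using hT)))

theorem eulerStep_mem (hB : EulerBound F z₀ T h₀ M L B) {h : ℝ} (hh : 0 < h) (hh₀ : h ≤ h₀)
    {t : ℝ} (ht : t ∈ Icc 0 T) : eulerStep F h z₀ t ∈ B :=
  hB.mem h hh hh₀ _ ((floor_div_mul_le hh ht.1).trans ht.2)

theorem norm_sub_eulerStep_le (hB : EulerBound F z₀ T h₀ M L B) {h : ℝ} (hh : 0 < h)
    (hh₀ : h ≤ h₀) {t : ℝ} (ht : t ∈ Icc 0 T) :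
    ‖eulerPath F h z₀ t - eulerStep F h z₀ t‖ ≤ h * M :=
  (norm_eulerPath_sub_eulerStep_le F hh z₀ ht.1).trans
    (mul_le_mul_of_nonneg_left (hB.bound _ (hB.eulerStep_mem hh hh₀ ht)) hh.le)

theorem norm_sub_le (hB : EulerBound F z₀ T h₀ M L B) {h : ℝ} (hh : 0 < h) (hh₀ : h ≤ h₀)
    {s t : ℝ} (hs : 0 ≤ s) (hst : s ≤ t) (ht : t ≤ T) :
    ‖eulerPath F h z₀ t - eulerPath F h z₀ s‖ ≤ M * (t - s) := by
  refine norm_image_sub_le_of_norm_deriv_right_le_segment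
    (f' := fun r => F (eulerStep F h z₀ r)) (a := s) (b := T)
    ((continuousOn_eulerPath F hh z₀).mono fun r hr => hs.trans hr.1)
    (fun r hr => hasDerivWithinAt_eulerPath F hh z₀ (hs.trans hr.1))
    (fun r hr => hB.bound _ (hB.eulerStep_mem hh hh₀ ⟨hs.trans hr.1, hr.2.le⟩)) t ⟨hst, ht⟩

/-- The field is evaluated at nodes while the polygons are compared at the current time. Each
polygon is within `step * M` of its node, so the one-sided Lipschitz estimate for the nodes
transfers to the polygons with an error linear in `h + k`. -/
theorem norm_sub_sq_le (hB : EulerBound F z₀ T h₀ M L B) {h k : ℝ} (hh : 0 < h) (hh₀ : h ≤ h₀)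
    (hh1 : h ≤ 1) (hk : 0 < k) (hk₀ : k ≤ h₀) (hk1 : k ≤ 1) {t : ℝ} (ht : t ∈ Icc 0 T) :
    ‖eulerPath F h z₀ t - eulerPath F k z₀ t‖ ^ 2 ≤
      (8 * L + 4) * M ^ 2 * (h + k) * Real.exp ((4 * L + 1) * T) := by
  have hL := hB.nonneg
  have hM : 0 ≤ M := (norm_nonneg _).trans (hB.bound _ (hB.eulerStep_mem hh hh₀ ht))
  have key := le_gronwallBound_of_liminf_deriv_right_le
    (f := fun s => ‖eulerPath F h z₀ s - eulerPath F k z₀ s‖ ^ 2)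
    (f' := fun s => 2 * inner ℝ (eulerPath F h z₀ s - eulerPath F k z₀ s)
      (F (eulerStep F h z₀ s) - F (eulerStep F k z₀ s)))
    -- The rate is `4L` because `‖a - b‖² ≤ 2‖z - w‖² + 2(M(h + k))²`; the extra `1` keeps it
    -- nonzero in the closed form of the Grönwall bound. The error collects `4M²(h + k)` and, since
    -- `h + k ≤ 2`, `8LM²(h + k)`.
    (δ := 0) (K := 4 * L + 1) (ε := (8 * L + 4) * M ^ 2 * (h + k)) (a := 0) (b := T)
    ((((continuousOn_eulerPath F hh z₀).sub (continuousOn_eulerPath F hk z₀)).norm.pow 2).mono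
      fun r hr => hr.1)
    (fun s hs r hr => by
      have h1 := ((hasDerivWithinAt_eulerPath F hh z₀ hs.1).sub
        (hasDerivWithinAt_eulerPath F hk z₀ hs.1)).norm_sq
      exact h1.liminf_right_slope_le hr)
    (by simp [eulerPath_zero])
    (fun s hs => by
      have hs' : s ∈ Icc 0 T := ⟨hs.1, hs.2.le⟩
      have ha := hB.eulerStep_mem hh hh₀ hs'
      have hb := hB.eulerStep_mem hk hk₀ hs'
      have h1 := hB.norm_sub_eulerStep_le hh hh₀ hs'
      have h2 := hB.norm_sub_eulerStep_le hk hk₀ hs'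
      have h3 := hB.lipschitz _ ha _ hb
      have h4 := hB.bound _ ha
      have h5 := hB.bound _ hb
      generalize eulerStep F h z₀ s = a at *
      generalize eulerStep F k z₀ s = b at *
      generalize eulerPath F h z₀ s = z at *
      generalize eulerPath F k z₀ s = w at *
      have h6 : ‖(z - w) - (a - b)‖ ≤ M * (h + k) := by
        have : (z - w) - (a - b) = (z - a) - (w - b) := by abel
        rw [this]
        refine (_root_.norm_sub_le _ _).trans ?_
        linarith
      have h7 : inner ℝ (F a - F b) ((z - w) - (a - b)) ≤ 2 * M * (M * (h + k)) := by
        refine (real_inner_le_norm _ _).trans ?_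
        gcongr
        refine (_root_.norm_sub_le _ _).trans ?_
        linarith
      have h8 : inner ℝ (z - w) (F a - F b) =
          inner ℝ (F a - F b) (a - b) + inner ℝ (F a - F b) ((z - w) - (a - b)) := by
        rw [← inner_add_right, real_inner_comm]
        congr 1
        abel
      have h9 : ‖a - b‖ ^ 2 ≤ 2 * ‖z - w‖ ^ 2 + 2 * (M * (h + k)) ^ 2 := by
        have : ‖a - b‖ ≤ ‖z - w‖ + M * (h + k) := by
          have h10 := _root_.norm_sub_le (z - w) ((z - w) - (a - b))
          rw [sub_sub_cancel] at h10
          linarith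
        nlinarith [norm_nonneg (a - b), sq_nonneg (‖z - w‖ - M * (h + k))]
      have h10 : (M * (h + k)) ^ 2 ≤ 2 * M ^ 2 * (h + k) := by
        rw [mul_pow]
        nlinarith [mul_nonneg (sq_nonneg M) (mul_nonneg (add_pos hh hk).le
          (by linarith : 0 ≤ 2 - (h + k)))]
      have h11 := mul_le_mul_of_nonneg_left (h9.trans
        (add_le_add_right (mul_le_mul_of_nonneg_left h10 zero_le_two) _)) hL
      rw [h8]
      nlinarith [sq_nonneg ‖z - w‖]) t ht
  refine key.trans ?_
  rw [gronwallBound_of_K_ne_0 (by positivity)]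
  have hexp : Real.exp ((4 * L + 1) * (t - 0)) ≤ Real.exp ((4 * L + 1) * T) := by
    rw [Real.exp_le_exp]
    have := ht.2
    gcongr
    linarith
  have hε : 0 ≤ (8 * L + 4) * M ^ 2 * (h + k) := by positivity
  have hdiv : (8 * L + 4) * M ^ 2 * (h + k) / (4 * L + 1) ≤ (8 * L + 4) * M ^ 2 * (h + k) :=
    div_le_self hε (by linarith)
  beta_reduce
  rw [zero_mul, zero_add]
  have h1 : Real.exp ((4 * L + 1) * (t - 0)) - 1 ≤ Real.exp ((4 * L + 1) * T) := by linarith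
  calc _ ≤ (8 * L + 4) * M ^ 2 * (h + k) / (4 * L + 1) * Real.exp ((4 * L + 1) * T) := by
        gcongr
    _ ≤ _ := by gcongr

end EulerBound

/-- The sequence of step sizes `1 / (n + 1)`. -/
noncomputable def stepSize (n : ℕ) : ℝ := 1 / ((n : ℝ) + 1)

theorem stepSize_pos (n : ℕ) : 0 < stepSize n := Nat.one_div_pos_of_nat

theorem tendsto_stepSize : Tendsto stepSize atTop (𝓝 0) := tendsto_one_div_add_atTop_nhds_zero_nat

/-- Convergence of the explicit Euler scheme, locally uniformly in time. -/
theorem exists_tendstoUniformlyOn_eulerPath [CompleteSpace E] {F : E → E} {z₀ : E}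
    (hF : ∀ T : ℝ, 0 < T → ∃ h₀ M L : ℝ, ∃ B : Set E, EulerBound F z₀ T h₀ M L B) :
    ∃ z : ℝ → E, ∀ T : ℝ, 0 < T →
      TendstoUniformlyOn (fun n => eulerPath F (stepSize n) z₀) z atTop (Icc 0 T) := by
  have hC : ∀ T : ℝ, 0 < T →
      UniformCauchySeqOn (fun n => eulerPath F (stepSize n) z₀) atTop (Icc 0 T) := by
    intro T hT
    obtain ⟨h₀, M, L, B, hB⟩ := hF T hT
    rw [Metric.uniformCauchySeqOn_iff]
    intro ε hε
    have hL := hB.nonneg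
    set C := (8 * L + 4) * M ^ 2 * Real.exp ((4 * L + 1) * T) with hCdef
    have hC0 : 0 ≤ C := by positivity
    -- The last bound makes `C * (h + k) < ε²` for two such steps; the `+ 1` covers `C = 0`.
    have h1 : ∀ᶠ n in atTop, stepSize n < min (min 1 h₀) (ε ^ 2 / (2 * C + 1)) := by
      refine tendsto_stepSize.eventually_lt_const ?_
      have := hB.step_pos
      positivity
    obtain ⟨N, hN⟩ := eventually_atTop.1 h1
    refine ⟨N, fun m hm n hn t ht => ?_⟩
    have hm' := hN m hm
    have hn' := hN n hn
    simp only [lt_min_iff] at hm' hn'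
    have h2 := hB.norm_sub_sq_le (stepSize_pos m) hm'.1.2.le hm'.1.1.le (stepSize_pos n)
      hn'.1.2.le hn'.1.1.le ht
    have h3 : C * (stepSize m + stepSize n) < ε ^ 2 := by
      have h4 := hm'.2
      have h5 := hn'.2
      rw [lt_div_iff₀ (by positivity)] at h4 h5
      nlinarith [stepSize_pos m, stepSize_pos n]
    rw [dist_eq_norm]
    refine lt_of_pow_lt_pow_left₀ 2 hε.le (h2.trans_lt ?_)
    rw [hCdef] at h3
    linarith
  have hpt : ∀ t : ℝ, ∃ l, 0 ≤ t →
      Tendsto (fun n => eulerPath F (stepSize n) z₀ t) atTop (𝓝 l) := by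
    intro t
    by_cases ht : 0 ≤ t
    · obtain ⟨l, hl⟩ := cauchySeq_tendsto_of_complete
        ((hC (t + 1) (by linarith)).cauchySeq (x := t) ⟨ht, by linarith⟩)
      exact ⟨l, fun _ => hl⟩
    · exact ⟨0, fun h => absurd h ht⟩
  choose z hz using hpt
  exact ⟨z, fun T hT => (hC T hT).tendstoUniformlyOn_of_tendsto fun t ht => hz t ht.1⟩

end Euler

/-! ### Energy estimates and confinement of the Euler scheme. -/

section Energy

variable {H : Type*} [NormedAddCommGroup H]

theorem LipschitzOnBounded.exists_norm_sub_le {g : H → H} (hg : LipschitzOnBounded g) (R : ℝ) :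
    ∃ K : ℝ, 0 ≤ K ∧ ∀ x y : H, ‖x‖ ≤ R → ‖y‖ ≤ R → ‖g x - g y‖ ≤ K * ‖x - y‖ := by
  obtain ⟨K, hK⟩ := hg (Metric.closedBall 0 R) Metric.isBounded_closedBall
  refine ⟨K, K.2, fun x y hx hy => ?_⟩
  exact hK.norm_sub_le (by simpa using hx) (by simpa using hy)

theorem LipschitzOnBounded.exists_norm_le {g : H → H} (hg : LipschitzOnBounded g) (R : ℝ) :
    ∃ G : ℝ, 0 ≤ G ∧ ∀ x : H, ‖x‖ ≤ R → ‖g x‖ ≤ G := by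
  obtain ⟨K, hK0, hK⟩ := hg.exists_norm_sub_le (max R 0)
  refine ⟨‖g 0‖ + K * max R 0, by positivity, fun x hx => ?_⟩
  have h1 := hK x 0 (hx.trans (le_max_left _ _)) (by simp)
  have h2 := norm_le_insert' (g x) (g 0)
  have h3 : K * ‖x - 0‖ ≤ K * max R 0 := by
    rw [sub_zero]
    exact mul_le_mul_of_nonneg_left (hx.trans (le_max_left _ _)) hK0
  linarith

variable [InnerProductSpace ℝ H]

/-- The one-sided Lipschitz estimate in terms of differences: the monotone term `dp` has the good
sign and drops out, and the rest is Cauchy–Schwarz. It serves both the convergence of the scheme and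
uniqueness. -/
theorem inner_phase_le {β K : ℝ} (hβ : 0 ≤ β) (hK0 : 0 ≤ K) {dx dv dg dp : H}
    (h1 : ‖dg‖ ≤ K * ‖dx‖) (h2 : 0 ≤ inner ℝ dp dv) :
    inner ℝ (dv - β • dg) dx + inner ℝ (-dp - dg) dv ≤
      (1 + K + β * K) * (‖dx‖ ^ 2 + ‖dv‖ ^ 2) := by
  rw [inner_sub_left, inner_sub_left, inner_neg_left, real_inner_smul_left]
  have h7 := real_inner_le_norm dv dx
  have h8 := neg_le_of_abs_le (abs_real_inner_le_norm dg dx)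
  have h9 := neg_le_of_abs_le (abs_real_inner_le_norm dg dv)
  have h10 : ‖dg‖ * ‖dx‖ ≤ K * ‖dx‖ ^ 2 := by nlinarith [norm_nonneg dx]
  have h11 : ‖dg‖ * ‖dv‖ ≤ K * (‖dx‖ * ‖dv‖) := by nlinarith [norm_nonneg dv]
  have h12 : ‖dx‖ * ‖dv‖ ≤ ‖dx‖ ^ 2 + ‖dv‖ ^ 2 := by
    nlinarith [sq_nonneg (‖dx‖ - ‖dv‖), sq_nonneg (‖dx‖ + ‖dv‖)]
  have h13 := mul_le_mul_of_nonneg_left h12 hK0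
  have h14 : β * -inner ℝ dg dx ≤ β * (K * ‖dx‖ ^ 2) :=
    mul_le_mul_of_nonneg_left (by linarith) hβ
  have h15 : 0 ≤ β * (K * ‖dv‖ ^ 2) := by positivity
  linarith

/-- The first-order vector field `(x, v) ↦ (v - β g(x), -p(v) - g(x))`. -/
noncomputable def phaseField (g p : H → H) (β : ℝ) (z : WithLp 2 (H × H)) : WithLp 2 (H × H) :=
  WithLp.toLp 2 (z.snd - β • g z.fst, -p z.snd - g z.fst)

/-- Structural properties of the potential `f` with gradient `g` and of a selection `p` of the
dissipative term. -/
structure PhaseData (f : H → ℝ) (g p : H → H) (β : ℝ) : Prop where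
  nonneg : 0 ≤ β
  bddBelow : BddBelow (range f)
  gradient_inequality : ∀ x y, f x + inner ℝ (g x) (y - x) ≤ f y
  lipschitz : LipschitzOnBounded g
  dissipative : ∀ v, 0 ≤ inner ℝ (p v) v
  monotone : ∀ v w, 0 ≤ inner ℝ (p v - p w) (v - w)
  bounded : ∀ R : ℝ, ∃ P : ℝ, 0 ≤ P ∧ ∀ v, ‖v‖ ≤ R → ‖p v‖ ≤ P

namespace PhaseData

variable {f : H → ℝ} {g p : H → H} {β : ℝ}

/-- Convexity at the new point gives `f(x + d) ≤ f(x) + ⟪g(x + d), d⟫`. Replacing `g(x + d)` by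
`g(x)` costs `O(h²)`, the cross terms `⟪g x, v⟫` cancel against those of `‖v‖²/2`, and the `p` term
dissipates. The condition `h ≤ 1` keeps `x + d` in the ball where `K` is valid. -/
theorem energy_step (hd : PhaseData f g p β) {R V G P K h : ℝ} {x v : H} (hh : 0 ≤ h)
    (hh1 : h ≤ 1) (hx : ‖x‖ ≤ R) (hv : ‖v‖ ≤ V) (hG : ‖g x‖ ≤ G) (hP : ‖p v‖ ≤ P) (hK0 : 0 ≤ K)
    (hK : ∀ x y : H, ‖x‖ ≤ R + (V + β * G) → ‖y‖ ≤ R + (V + β * G) →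
      ‖g x - g y‖ ≤ K * ‖x - y‖) :
    f (x + h • (v - β • g x)) + ‖v + h • (-p v - g x)‖ ^ 2 / 2 + h * (β * ‖g x‖ ^ 2) ≤
      f x + ‖v‖ ^ 2 / 2 + h ^ 2 * (K * (V + β * G) ^ 2 + (P + G) ^ 2 / 2) := by
  have hβ := hd.nonneg
  have hc : ‖v - β • g x‖ ≤ V + β * G := by
    refine (_root_.norm_sub_le _ _).trans ?_
    rw [norm_smul, Real.norm_eq_abs, abs_of_nonneg hβ]
    gcongr
  set c := V + β * G with hcdef
  have hc0 : 0 ≤ c := (norm_nonneg _).trans hc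
  set d := h • (v - β • g x) with hddef
  have hdn : ‖d‖ ≤ h * c := by
    rw [hddef, norm_smul, Real.norm_eq_abs, abs_of_nonneg hh]
    gcongr
  have hdc : ‖d‖ ≤ c := hdn.trans (mul_le_of_le_one_left hc0 hh1)
  have h1 := hd.gradient_inequality (x + d) x
  have h2 : inner ℝ (g (x + d)) (x - (x + d)) = -(inner ℝ (g (x + d) - g x) d + inner ℝ (g x) d) := by
    rw [← inner_add_left, sub_add_cancel, ← inner_neg_right]
    congr 1
    abel
  have h3 : inner ℝ (g (x + d) - g x) d ≤ K * (h * c) ^ 2 := by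
    refine (real_inner_le_norm _ _).trans ?_
    have h4 := hK (x + d) x ((norm_add_le _ _).trans (add_le_add hx hdc)) (by linarith)
    rw [add_sub_cancel_left] at h4
    calc _ ≤ K * ‖d‖ * ‖d‖ := by gcongr
      _ ≤ K * (h * c) * (h * c) := by gcongr
      _ = _ := by ring
  have h5 : inner ℝ (g x) d = h * (inner ℝ (g x) v - β * ‖g x‖ ^ 2) := by
    rw [hddef, real_inner_smul_right, inner_sub_right, real_inner_smul_right,
      real_inner_self_eq_norm_sq]
  have h6 : ‖v + h • (-p v - g x)‖ ^ 2 =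
      ‖v‖ ^ 2 - 2 * h * (inner ℝ (p v) v + inner ℝ (g x) v) + h ^ 2 * ‖-p v - g x‖ ^ 2 := by
    rw [norm_add_sq_real, norm_smul, real_inner_smul_right, inner_sub_right, inner_neg_right,
      mul_pow, Real.norm_eq_abs, sq_abs, real_inner_comm v (p v), real_inner_comm v (g x)]
    ring
  have h7 : ‖-p v - g x‖ ^ 2 ≤ (P + G) ^ 2 := by
    have : ‖-p v - g x‖ ≤ P + G := (_root_.norm_sub_le _ _).trans (by rw [norm_neg]; gcongr)
    gcongr
  have h8 := mul_le_mul_of_nonneg_left h7 (sq_nonneg h)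
  have h9 := mul_nonneg hh (hd.dissipative v)
  rw [h2, h5] at h1
  rw [h6]
  linarith

theorem norm_phaseField_le (hd : PhaseData f g p β) {V G P : ℝ} {z : WithLp 2 (H × H)}
    (hv : ‖z.snd‖ ≤ V) (hG : ‖g z.fst‖ ≤ G) (hP : ‖p z.snd‖ ≤ P) :
    ‖phaseField g p β z‖ ≤ (V + β * G) + (P + G) := by
  have hβ := hd.nonneg
  have hV0 : 0 ≤ V := (norm_nonneg _).trans hv
  have hG0 : 0 ≤ G := (norm_nonneg _).trans hG
  have hP0 : 0 ≤ P := (norm_nonneg _).trans hP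
  have h1 : ‖phaseField g p β z‖ ^ 2 =
      ‖z.snd - β • g z.fst‖ ^ 2 + ‖-p z.snd - g z.fst‖ ^ 2 :=
    WithLp.prod_norm_sq_eq_of_L2 _
  have h2 : ‖z.snd - β • g z.fst‖ ≤ V + β * G := by
    refine (_root_.norm_sub_le _ _).trans ?_
    rw [norm_smul, Real.norm_eq_abs, abs_of_nonneg hβ]
    gcongr
  have h3 : ‖-p z.snd - g z.fst‖ ≤ P + G :=
    (_root_.norm_sub_le _ _).trans (by rw [norm_neg]; exact add_le_add (hP) (hG))
  refine le_of_sq_le_sq ?_ (by positivity)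
  rw [h1]
  nlinarith [norm_nonneg (z.snd - β • g z.fst), norm_nonneg (-p z.snd - g z.fst),
    mul_nonneg (add_nonneg hV0 (mul_nonneg hβ hG0)) (add_nonneg hP0 hG0)]

theorem inner_phaseField_sub_le (hd : PhaseData f g p β) {K : ℝ} (hK0 : 0 ≤ K)
    {a b : WithLp 2 (H × H)} (h1 : ‖g a.fst - g b.fst‖ ≤ K * ‖a.fst - b.fst‖) :
    inner ℝ (phaseField g p β a - phaseField g p β b) (a - b) ≤
      (1 + K + β * K) * ‖a - b‖ ^ 2 := by
  have hβ := hd.nonneg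
  have h2 := hd.monotone a.snd b.snd
  have h3 : ‖a - b‖ ^ 2 = ‖a.fst - b.fst‖ ^ 2 + ‖a.snd - b.snd‖ ^ 2 :=
    WithLp.prod_norm_sq_eq_of_L2 _
  have h4 : inner ℝ (phaseField g p β a - phaseField g p β b) (a - b) =
      inner ℝ ((a.snd - β • g a.fst) - (b.snd - β • g b.fst)) (a.fst - b.fst) +
      inner ℝ ((-p a.snd - g a.fst) - (-p b.snd - g b.fst)) (a.snd - b.snd) :=
    WithLp.prod_inner_apply _ _
  have h5 : (a.snd - β • g a.fst) - (b.snd - β • g b.fst) =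
      (a.snd - b.snd) - β • (g a.fst - g b.fst) := by
    rw [smul_sub]
    abel
  have h6 : (-p a.snd - g a.fst) - (-p b.snd - g b.fst) =
      -(p a.snd - p b.snd) - (g a.fst - g b.fst) := by abel
  rw [h4, h3, h5, h6]
  exact inner_phase_le hβ hK0 h1 h2

/-- The danger is circularity: the position bound must not depend on the bound `G` for the gradient,
which itself depends on the position bound. The dissipation `β‖g‖²` summed along the scheme is
controlled by the energy, and `β‖g‖ ≤ β(1 + ‖g‖²)` turns this into a position bound chosen before
`G`. -/
theorem exists_eulerBound (hd : PhaseData f g p β) (z₀ : WithLp 2 (H × H)) {T : ℝ} (hT : 0 < T) :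
    ∃ h₀ M L : ℝ, ∃ B : Set (WithLp 2 (H × H)), EulerBound (phaseField g p β) z₀ T h₀ M L B := by
  have hβ := hd.nonneg
  obtain ⟨m, hm⟩ := hd.bddBelow
  have hm : ∀ x, m ≤ f x := fun x => hm ⟨x, rfl⟩
  -- The `+ 1` is room for the accumulated discretisation error `n * C * h² ≤ C * T * h ≤ 1`.
  set e := f z₀.fst - m + ‖z₀.snd‖ ^ 2 / 2 + 1 with he
  have he0 : 0 < e := by
    have := hm z₀.fst
    positivity
  set V := Real.sqrt (2 * e) with hV
  have hV2 : V ^ 2 = 2 * e := Real.sq_sqrt (by positivity)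
  have hV0 : 0 ≤ V := Real.sqrt_nonneg _
  set R := ‖z₀.fst‖ + T * (V + β) + e with hR
  obtain ⟨G, hG0, hG⟩ := hd.lipschitz.exists_norm_le R
  obtain ⟨P, hP0, hP⟩ := hd.bounded V
  obtain ⟨K, hK0, hK⟩ := hd.lipschitz.exists_norm_sub_le (R + (V + β * G))
  set C := K * (V + β * G) ^ 2 + (P + G) ^ 2 / 2 with hC
  have hC0 : 0 ≤ C := by positivity
  refine ⟨min 1 (1 / (C * T + 1)), (V + β * G) + (P + G), 1 + K + β * K,
    {z | ‖z.fst‖ ≤ R ∧ ‖z.snd‖ ≤ V}, ⟨by positivity, by positivity, ?_, ?_, ?_⟩⟩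
  · intro h hh hh₀ n hn
    obtain ⟨hh1, hh2⟩ := le_min_iff.1 hh₀
    have hh3 : C * T * h ≤ 1 := by
      rw [le_div_iff₀ (by positivity)] at hh2
      linarith
    set a := eulerNode (phaseField g p β) h z₀ with ha
    have hmem : ∀ n : ℕ, n * h ≤ T → ∀ D : ℝ, 0 ≤ D →
        f (a n).fst + ‖(a n).snd‖ ^ 2 / 2 + D ≤
          f z₀.fst + ‖z₀.snd‖ ^ 2 / 2 + n * (C * h ^ 2) →
        ‖(a n).fst‖ ≤ ‖z₀.fst‖ + n * h * (V + β) + D →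
        ‖(a n).fst‖ ≤ R ∧ ‖(a n).snd‖ ≤ V := by
      intro n hn D hD h1 h2
      have h3 : (n : ℝ) * (C * h ^ 2) ≤ 1 := by
        have := mul_le_mul_of_nonneg_right hn (mul_nonneg hC0 hh.le)
        nlinarith
      have h4 := hm (a n).fst
      constructor
      · have := mul_le_mul_of_nonneg_right hn (add_nonneg hV0 hβ)
        have := sq_nonneg ‖(a n).snd‖
        linarith
      · refine le_of_sq_le_sq ?_ hV0
        rw [hV2]
        linarith
    -- `D` is the dissipation accumulated so far, the sum of `h * β * ‖g‖²`. It appears on the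
    -- favourable side of the energy balance, hence is at most `e`, and pays for the displacement
    -- due to `-βg`.
    have hind : ∀ n : ℕ, n * h ≤ T → ∃ D : ℝ, 0 ≤ D ∧
        f (a n).fst + ‖(a n).snd‖ ^ 2 / 2 + D ≤
          f z₀.fst + ‖z₀.snd‖ ^ 2 / 2 + n * (C * h ^ 2) ∧
        ‖(a n).fst‖ ≤ ‖z₀.fst‖ + n * h * (V + β) + D := by
      intro n
      induction n with
      | zero => exact fun _ => ⟨0, le_rfl, by simp [ha, eulerNode], by simp [ha, eulerNode]⟩
      | succ n ih =>
        intro hn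
        push_cast at hn ⊢
        have hn' : n * h ≤ T := by linarith
        obtain ⟨D, hD, h1, h2⟩ := ih hn'
        obtain ⟨hx, hv⟩ := hmem n hn' D hD h1 h2
        have hstep := hd.energy_step hh.le hh1 hx hv (hG _ hx) (hP _ hv) hK0 hK
        rw [← hC] at hstep
        have hfst : (a (n + 1)).fst =
            (a n).fst + h • ((a n).snd - β • g (a n).fst) := rfl
        have hsnd : (a (n + 1)).snd =
            (a n).snd + h • (-p (a n).snd - g (a n).fst) := rfl
        rw [hfst, hsnd]
        refine ⟨D + h * (β * ‖g (a n).fst‖ ^ 2), by positivity, by linarith, ?_⟩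
        have h3 : ‖(a n).snd - β • g (a n).fst‖ ≤ V + β * (1 + ‖g (a n).fst‖ ^ 2) := by
          refine (_root_.norm_sub_le _ _).trans ?_
          rw [norm_smul, Real.norm_eq_abs, abs_of_nonneg hβ]
          gcongr
          nlinarith [sq_nonneg (‖g (a n).fst‖ - 1)]
        have h4 := norm_add_le (a n).fst (h • ((a n).snd - β • g (a n).fst))
        rw [norm_smul, Real.norm_eq_abs, abs_of_pos hh] at h4
        have h5 := mul_le_mul_of_nonneg_left h3 hh.le
        linarith
    obtain ⟨D, hD, h1, h2⟩ := hind n hn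
    exact hmem n hn D hD h1 h2
  · rintro z ⟨hx, hv⟩
    exact hd.norm_phaseField_le hv (hG _ hx) (hP _ hv)
  · rintro a ⟨ha1, ha2⟩ b ⟨hb1, hb2⟩
    have hc : R ≤ R + (V + β * G) := by
      have : 0 ≤ V + β * G := by positivity
      linarith
    exact hd.inner_phaseField_sub_le hK0 (hK a.fst b.fst (ha1.trans hc) (hb1.trans hc))

end PhaseData
end Energy

/-! ### Limits of Euler polygons and their variational inequality. -/

section EulerLimit

open Filter

variable {E : Type*} [NormedAddCommGroup E] [InnerProductSpace ℝ E]

/-- A curve is an Euler limit if it is the locally uniform limit of Euler polygons with step sizes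
`1 / (n + 1)`; it is continued by its initial value to negative times. -/
structure IsEulerLimit (F : E → E) (z₀ : E) (z : ℝ → E) : Prop where
  eulerBound : ∀ T : ℝ, 0 < T → ∃ h₀ M L : ℝ, ∃ B : Set E, EulerBound F z₀ T h₀ M L B
  tendsto : ∀ T : ℝ, 0 < T →
    TendstoUniformlyOn (fun n => eulerPath F (stepSize n) z₀) z atTop (Icc 0 T)
  eq_max : ∀ t, z t = z (max t 0)

theorem exists_isEulerLimit [CompleteSpace E] {F : E → E} {z₀ : E}
    (hF : ∀ T : ℝ, 0 < T → ∃ h₀ M L : ℝ, ∃ B : Set E, EulerBound F z₀ T h₀ M L B) :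
    ∃ z : ℝ → E, IsEulerLimit F z₀ z := by
  obtain ⟨z, hz⟩ := exists_tendstoUniformlyOn_eulerPath hF
  refine ⟨fun t => z (max t 0), hF, fun T hT => (hz T hT).congr_right fun t ht => ?_, fun t => ?_⟩
  · simp only [max_eq_left ht.1]
  · simp

namespace IsEulerLimit

variable {F : E → E} {z₀ : E} {z : ℝ → E}

theorem tendsto_apply (hz : IsEulerLimit F z₀ z) {t : ℝ} (ht : 0 ≤ t) :
    Tendsto (fun n => eulerPath F (stepSize n) z₀ t) atTop (𝓝 (z t)) :=
  (hz.tendsto (t + 1) (by linarith)).tendsto_at ⟨ht, by linarith⟩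

theorem apply_zero (hz : IsEulerLimit F z₀ z) : z 0 = z₀ := by
  refine tendsto_nhds_unique (hz.tendsto_apply le_rfl) ?_
  simp only [eulerPath_zero]
  exact tendsto_const_nhds

theorem exists_lipschitzOnWith (hz : IsEulerLimit F z₀ z) {T : ℝ} (hT : 0 < T) :
    ∃ K : ℝ≥0, LipschitzOnWith K z (Icc 0 T) := by
  obtain ⟨h₀, M, L, B, hB⟩ := hz.eulerBound T hT
  have hM := hB.bound_nonneg hT.le
  have key : ∀ s ∈ Icc 0 T, ∀ t ∈ Icc 0 T, s ≤ t → ‖z t - z s‖ ≤ M * (t - s) := by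
    intro s hs t ht hst
    refine le_of_tendsto ((hz.tendsto_apply ht.1).sub (hz.tendsto_apply hs.1)).norm ?_
    filter_upwards [tendsto_stepSize.eventually_le_const hB.step_pos] with n hn
    exact hB.norm_sub_le (stepSize_pos n) hn hs.1 hst ht.2
  refine ⟨M.toNNReal, LipschitzOnWith.of_dist_le_mul fun s hs t ht => ?_⟩
  rw [dist_eq_norm, Real.dist_eq, Real.coe_toNNReal _ hM]
  rcases le_total s t with h | h
  · rw [norm_sub_rev, abs_sub_comm, abs_of_nonneg (sub_nonneg.2 h)]
    exact key s hs t ht h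
  · rw [abs_of_nonneg (sub_nonneg.2 h)]
    exact key t ht s hs h

theorem continuous (hz : IsEulerLimit F z₀ z) : Continuous z := by
  have h1 : ContinuousOn z (Ici 0) := by
    intro t ht
    obtain ⟨K, hK⟩ := hz.exists_lipschitzOnWith (T := t + 1) (by linarith [mem_Ici.1 ht])
    refine (hK.continuousOn t ⟨ht, by linarith⟩).mono_of_mem_nhdsWithin ?_
    rw [← Ici_inter_Iic]
    exact inter_mem_nhdsWithin _ (Iic_mem_nhds (by linarith))
  have h2 : z = fun t => z (max t 0) := funext hz.eq_max
  rw [h2]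
  exact h1.comp_continuous (by fun_prop) fun t => le_max_right t 0

theorem ae_differentiableAt [CompleteSpace E] (hz : IsEulerLimit F z₀ z) :
    ∀ᵐ t, 0 < t → DifferentiableAt ℝ z t := by
  have h1 : ∀ n : ℕ, ∀ᵐ t, t ∈ Ioo (0 : ℝ) (n + 1) → DifferentiableAt ℝ z t := fun n => by
    have hn : (0 : ℝ) < n + 1 := by positivity
    obtain ⟨K, hK⟩ := hz.exists_lipschitzOnWith hn
    exact ae_differentiableAt_of_lipschitzOnWith hn.le hK
  filter_upwards [ae_all_iff.2 h1] with t ht ht0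
  obtain ⟨n, hn⟩ := exists_nat_gt t
  exact ht n ⟨ht0, by linarith⟩

/-- A differential variational inequality along an Euler limit, read off from an upper bound of
`⟪F a, a - w⟫` by a continuous function of `a`. -/
theorem inner_deriv_le (hz : IsEulerLimit F z₀ z) {w : E} {Ψ : E → ℝ} (hΨ : Continuous Ψ)
    (hF : ∀ a, inner ℝ (F a) (a - w) ≤ Ψ a) {t : ℝ} (ht : 0 ≤ t) {z' : E}
    (hd : HasDerivAt z z' t) : inner ℝ z' (z t - w) ≤ Ψ (z t) := by
  refine le_of_forall_pos_le_add fun ε hε => ?_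
  obtain ⟨η, hη, hΨη⟩ := Metric.continuousAt_iff.1 (hΨ.continuousAt (x := z t)) (ε / 2) (by positivity)
  obtain ⟨h₀, M, L, B, hB⟩ := hz.eulerBound (t + 1) (by linarith)
  obtain ⟨δ, hδ, hzδ⟩ := Metric.continuousAt_iff.1 (hz.continuous.continuousAt (x := t))
    (η / 3) (by positivity)
  have hM := hB.bound_nonneg (by linarith)
  have hstep : ∀ᶠ n in atTop, stepSize n ≤ h₀ ∧ stepSize n * M < η / 3 ∧
      stepSize n * M * M < ε / 2 := by
    refine (tendsto_stepSize.eventually_le_const hB.step_pos).and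
      (Eventually.and ?_ ?_)
    · exact (by simpa using tendsto_stepSize.mul_const M :
        Tendsto (fun n => stepSize n * M) atTop (𝓝 0)).eventually_lt_const (by positivity)
    · exact (by simpa using (tendsto_stepSize.mul_const M).mul_const M :
        Tendsto (fun n => stepSize n * M * M) atTop (𝓝 0)).eventually_lt_const (by positivity)
  have hunif := Metric.tendstoUniformlyOn_iff.1 (hz.tendsto (t + 1) (by linarith)) (η / 3)
    (by positivity)
  -- An integrated inequality, proved for the polygons and passed to the limit; dividing by `s - t`
  -- then uses the derivative of `z` at `t` only.
  have key : ∀ s ∈ Ioo t (t + min δ 1),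
      ‖z s - w‖ ^ 2 - ‖z t - w‖ ^ 2 ≤ 2 * (Ψ (z t) + ε) * (s - t) := by
    intro s hs
    have hs1 : s < t + 1 := hs.2.trans_le (by linarith [min_le_right δ 1])
    refine le_of_tendsto
      ((((hz.tendsto_apply (ht.trans hs.1.le)).sub_const w).norm.pow 2).sub
        (((hz.tendsto_apply ht).sub_const w).norm.pow 2)) ?_
    filter_upwards [hstep, hunif] with n hn hun
    have h1 := image_le_of_deriv_right_le_deriv_boundary
      (f := fun r => ‖eulerPath F (stepSize n) z₀ r - w‖ ^ 2)
      (f' := fun r => 2 * inner ℝ (eulerPath F (stepSize n) z₀ r - w)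
        (F (eulerStep F (stepSize n) z₀ r)))
      (a := t) (b := s)
      (B := fun r => ‖eulerPath F (stepSize n) z₀ t - w‖ ^ 2 + 2 * (Ψ (z t) + ε) * (r - t))
      (B' := fun _ => 2 * (Ψ (z t) + ε))
      ((((continuousOn_eulerPath F (stepSize_pos n) z₀).sub continuousOn_const).norm.pow 2).mono
        fun r hr => ht.trans hr.1)
      (fun r hr => ((hasDerivWithinAt_eulerPath F (stepSize_pos n) z₀
        (ht.trans hr.1)).sub_const w).norm_sq)
      (by simp) (by fun_prop)
      (fun r _ => by
        simpa using (((hasDerivAt_id r).sub_const t).const_mul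
          (2 * (Ψ (z t) + ε))).hasDerivWithinAt)
      (fun r hr => by
        have hr' : r ∈ Icc 0 (t + 1) := ⟨ht.trans hr.1, by linarith [hr.2]⟩
        have h2 := hB.norm_sub_eulerStep_le (stepSize_pos n) hn.1 hr'
        have h3 := hB.bound _ (hB.eulerStep_mem (stepSize_pos n) hn.1 hr')
        have h4 := hun r hr'
        have h5 : dist (z r) (z t) < η / 3 := by
          refine hzδ ?_
          rw [Real.dist_eq, abs_of_nonneg (sub_nonneg.2 hr.1)]
          linarith [hr.2, hs.2, min_le_left δ 1]
        rw [← dist_eq_norm] at h2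
        have h6 := hF (eulerStep F (stepSize n) z₀ r)
        -- Three gaps of size less than `η / 3`: node to polygon, polygon to limit, and limit at `r`
        -- to limit at `t`.
        have h7 : dist (eulerStep F (stepSize n) z₀ r) (z t) < η := by
          have h8 := dist_triangle4 (eulerStep F (stepSize n) z₀ r)
            (eulerPath F (stepSize n) z₀ r) (z r) (z t)
          rw [dist_comm (eulerStep F (stepSize n) z₀ r) (eulerPath _ _ _ _),
            dist_comm _ (z r)] at h8
          linarith [hn.2.1]
        have h8 := hΨη h7
        rw [Real.dist_eq] at h8
        have h9 := lt_of_abs_lt h8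
        rw [dist_eq_norm] at h2
        have h10 : inner ℝ (F (eulerStep F (stepSize n) z₀ r))
            (eulerPath F (stepSize n) z₀ r - eulerStep F (stepSize n) z₀ r) ≤
            stepSize n * M * M := by
          refine (real_inner_le_norm _ _).trans ?_
          rw [mul_comm]
          exact mul_le_mul h2 h3 (norm_nonneg _) (mul_nonneg (stepSize_pos n).le hM)
        have h11 : inner ℝ (eulerPath F (stepSize n) z₀ r - w)
            (F (eulerStep F (stepSize n) z₀ r)) =
            inner ℝ (F (eulerStep F (stepSize n) z₀ r)) (eulerStep F (stepSize n) z₀ r - w) +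
            inner ℝ (F (eulerStep F (stepSize n) z₀ r))
              (eulerPath F (stepSize n) z₀ r - eulerStep F (stepSize n) z₀ r) := by
          rw [← inner_add_right, real_inner_comm]
          congr 1
          abel
        rw [h11]
        linarith [hn.2.2]) (right_mem_Icc.2 hs.1.le)
    linarith
  have h1 : HasDerivAt (fun s => ‖z s - w‖ ^ 2) (2 * inner ℝ (z t - w) z') t :=
    (hd.sub_const w).norm_sq
  have h2 : Tendsto (slope (fun s => ‖z s - w‖ ^ 2) t) (𝓝[>] t)
      (𝓝 (2 * inner ℝ (z t - w) z')) :=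
    (hasDerivWithinAt_iff_tendsto_slope' self_notMem_Ioi).1 h1.hasDerivWithinAt
  have h3 : 2 * inner ℝ (z t - w) z' ≤ 2 * (Ψ (z t) + ε) := by
    refine le_of_tendsto h2 ?_
    filter_upwards [Ioo_mem_nhdsGT (show t < t + min δ 1 by linarith [lt_min hδ one_pos])]
      with s hs
    rw [slope_def_field, div_le_iff₀ (sub_pos.2 hs.1)]
    exact key s hs
  rw [real_inner_comm]
  linarith

end IsEulerLimit
end EulerLimit

/-! ### Properties of the potentials `f` and `φ`. -/

section Potential

open Filter

variable {H : Type*} [NormedAddCommGroup H] [InnerProductSpace ℝ H]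

theorem inner_sub_nonneg_of_mem_subdifferential {φ : H → ℝ} {v w p q : H}
    (hp : p ∈ subdifferential φ v) (hq : q ∈ subdifferential φ w) :
    0 ≤ inner ℝ (p - q) (v - w) := by
  have h1 := hp w
  have h2 := hq v
  rw [← neg_sub v w, inner_neg_right] at h1
  rw [inner_sub_left]
  linarith

variable [CompleteSpace H]

theorem contDiff_gradient {f : H → ℝ} (hf : ContDiff ℝ 2 f) : ContDiff ℝ 1 (gradient f) := by
  -- The Riesz isomorphism is conjugate-linear in form; over `ℝ` it is repackaged as a linear map so
  -- that smoothness composes.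
  let D : StrongDual ℝ H →L[ℝ] H := LinearMap.mkContinuous
    { toFun := (InnerProductSpace.toDual ℝ H).symm
      map_add' := fun a b => map_add _ a b
      map_smul' := fun c a => by simp } 1 (fun a => by simp)
  exact D.contDiff.comp (hf.fderiv_right (m := 1) (by norm_num))

theorem gradient_inequality {f : H → ℝ} (hc : ConvexOn ℝ univ f) (hd : Differentiable ℝ f)
    (x y : H) : f x + inner ℝ (gradient f x) (y - x) ≤ f y := by
  have h1 : ConvexOn ℝ univ (f ∘ AffineMap.lineMap (k := ℝ) x y) := by
    simpa using hc.comp_affineMap (AffineMap.lineMap (k := ℝ) x y)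
  have h2 : HasDerivAt (f ∘ AffineMap.lineMap (k := ℝ) x y)
      (inner ℝ (gradient f x) (y - x)) 0 := by
    have h3 : HasFDerivAt f (fderiv ℝ f x) (AffineMap.lineMap (k := ℝ) x y 0) := by
      rw [AffineMap.lineMap_apply_zero]
      exact (hd x).hasFDerivAt
    have h4 := h3.comp_hasDerivAt 0 AffineMap.hasDerivAt_lineMap
    rwa [(hd x).hasGradientAt.fderiv_apply] at h4
  have h5 := h1.le_slope_of_hasDerivAt (mem_univ 0) (mem_univ 1) one_pos h2
  rw [slope_def_field] at h5
  simp only [Function.comp_apply, AffineMap.lineMap_apply_one, AffineMap.lineMap_apply_zero,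
    sub_zero, div_one] at h5
  linarith

/-- The selection is the minimal section, whose minimality supplies boundedness on bounded sets.
Dissipativity is the subgradient inequality tested at `0`, where `φ` vanishes. -/
theorem exists_phaseData {f φ : H → ℝ} {β : ℝ} (hf_convex : ConvexOn ℝ univ f)
    (hf_C2 : ContDiff ℝ 2 f) (hf_bdd : BddBelow (range f))
    (hf_lip : LipschitzOnBounded (gradient f)) (hφ : IsDampingPotential φ) (hβ : 0 ≤ β) :
    ∃ p : H → H, (∀ v, p v ∈ subdifferential φ v) ∧ PhaseData f (gradient f) p β := by
  choose p hp _ using existsUnique_isMinimalSection hφ.convex hφ.continuous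
  refine ⟨p, fun v => (hp v).1, hβ, hf_bdd,
    gradient_inequality hf_convex (hf_C2.differentiable two_ne_zero), hf_lip, fun v => ?_,
    fun v w => inner_sub_nonneg_of_mem_subdifferential (hp v).1 (hp w).1, fun R => ?_⟩
  · have h1 := (hp v).1 0
    rw [zero_sub, inner_neg_right, hφ.map_zero] at h1
    linarith [hφ.nonneg v]
  · obtain ⟨M, hM⟩ := hφ.bounded_minimalSection (max R 1) (by positivity)
    exact ⟨max M 0, le_max_right _ _, fun v hv =>
      (hM v (p v) (hv.trans (le_max_left _ _)) (hp v)).trans (le_max_left _ _)⟩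

end Potential

/-! ### Existence of a strong global solution. -/

section Existence

open Filter

variable {H : Type*} [NormedAddCommGroup H]

theorem lipschitzOnWith_fst {z : ℝ → WithLp 2 (H × H)} {K : ℝ≥0} {s : Set ℝ}
    (h : LipschitzOnWith K z s) : LipschitzOnWith K (fun t => (z t).fst) s :=
  LipschitzOnWith.of_dist_le_mul fun a ha b hb => by
    refine le_trans ?_ (h.dist_le_mul a ha b hb)
    rw [dist_eq_norm, dist_eq_norm]
    exact WithLp.norm_fst_le H (z a - z b)

theorem lipschitzOnWith_snd {z : ℝ → WithLp 2 (H × H)} {K : ℝ≥0} {s : Set ℝ}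
    (h : LipschitzOnWith K z s) : LipschitzOnWith K (fun t => (z t).snd) s :=
  LipschitzOnWith.of_dist_le_mul fun a ha b hb => by
    refine le_trans ?_ (h.dist_le_mul a ha b hb)
    rw [dist_eq_norm, dist_eq_norm]
    exact WithLp.norm_snd_le H (z a - z b)

variable [InnerProductSpace ℝ H]

theorem hasDerivAt_fst {z : ℝ → WithLp 2 (H × H)} {z' : WithLp 2 (H × H)} {t : ℝ}
    (h : HasDerivAt z z' t) : HasDerivAt (fun s => (z s).fst) z'.fst t :=
  (WithLp.fstL 2 ℝ H H).hasFDerivAt.comp_hasDerivAt t h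

theorem hasDerivAt_snd {z : ℝ → WithLp 2 (H × H)} {z' : WithLp 2 (H × H)} {t : ℝ}
    (h : HasDerivAt z z' t) : HasDerivAt (fun s => (z s).snd) z'.snd t :=
  (WithLp.sndL 2 ℝ H H).hasFDerivAt.comp_hasDerivAt t h

/-- The derivative of an Euler limit of the phase field solves the first-order inclusion. -/
theorem deriv_of_isEulerLimit_phaseField {g p : H → H} {φ : H → ℝ} {β : ℝ}
    (hφ : Continuous φ) (hg : Continuous g) (hp : ∀ v, p v ∈ subdifferential φ v)
    {z₀ : WithLp 2 (H × H)} {z : ℝ → WithLp 2 (H × H)}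
    (hz : IsEulerLimit (phaseField g p β) z₀ z) {t : ℝ} (ht : 0 ≤ t) {z' : WithLp 2 (H × H)}
    (hd : HasDerivAt z z' t) :
    z'.fst = (z t).snd - β • g (z t).fst ∧
      -z'.snd - g (z t).fst ∈ subdifferential φ (z t).snd := by
  -- The subgradient inequality replaces the possibly discontinuous `p` by `φ w - φ v`, which is
  -- continuous in the state.
  have key : ∀ y w : H, inner ℝ z'.fst ((z t).fst - y) + inner ℝ z'.snd ((z t).snd - w) ≤
      inner ℝ ((z t).snd - β • g (z t).fst) ((z t).fst - y) +
        (φ w - φ (z t).snd - inner ℝ (g (z t).fst) ((z t).snd - w)) := by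
    intro y w
    have h1 := hz.inner_deriv_le (w := WithLp.toLp 2 (y, w))
      (Ψ := fun a => inner ℝ (a.snd - β • g a.fst) (a.fst - y) +
        (φ w - φ a.snd - inner ℝ (g a.fst) (a.snd - w))) ?_ ?_ ht hd
    · exact (WithLp.prod_inner_apply _ _).symm.trans_le h1
    · have h2 : Continuous fun a : WithLp 2 (H × H) => a.fst := (WithLp.fstL 2 ℝ H H).continuous
      have h3 : Continuous fun a : WithLp 2 (H × H) => a.snd := (WithLp.sndL 2 ℝ H H).continuous
      fun_prop
    · intro a
      have h2 : inner ℝ (phaseField g p β a) (a - WithLp.toLp 2 (y, w)) =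
          inner ℝ (a.snd - β • g a.fst) (a.fst - y) +
          inner ℝ (-p a.snd - g a.fst) (a.snd - w) := WithLp.prod_inner_apply _ _
      have h3 := hp a.snd w
      rw [← neg_sub a.snd w, inner_neg_right] at h3
      rw [h2, inner_sub_left (-p a.snd), inner_neg_left]
      linarith
  have hfst : z'.fst = (z t).snd - β • g (z t).fst := by
    -- The test point makes `(z t).fst - y` the defect of the first equation, so that its squared
    -- norm is at most `0`.
    have h1 := key ((z t).fst - (z'.fst - ((z t).snd - β • g (z t).fst))) (z t).snd
    simp only [sub_sub_cancel, sub_self, inner_zero_right] at h1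
    have h2 : inner ℝ (z'.fst - ((z t).snd - β • g (z t).fst))
        (z'.fst - ((z t).snd - β • g (z t).fst)) ≤ (0 : ℝ) := by
      rw [inner_sub_left]
      linarith
    rw [real_inner_self_eq_norm_sq] at h2
    exact sub_eq_zero.1 (norm_eq_zero.1 (pow_eq_zero_iff two_ne_zero |>.1
      (le_antisymm h2 (sq_nonneg _))))
  refine ⟨hfst, fun w => ?_⟩
  have h1 := key (z t).fst w
  simp only [sub_self, inner_zero_right] at h1
  rw [inner_sub_left, inner_neg_left, ← neg_sub (z t).snd w, inner_neg_right, inner_neg_right]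
  linarith

variable [CompleteSpace H]

/-- A Lipschitz curve whose derivative agrees almost everywhere with a continuous function is a
primitive of it. -/
theorem eq_integral_of_ae_hasDerivAt {x c : ℝ → H} {K : ℝ≥0} {T : ℝ} (hT : 0 < T)
    (hx : LipschitzOnWith K x (Icc 0 T)) (hc : Continuous c)
    (hd : ∀ᵐ t, t ∈ Ioo 0 T → HasDerivAt x (c t) t) :
    ∀ t ∈ Icc 0 T, x t = x 0 + ∫ s in (0 : ℝ)..t, c s := by
  have hX : ∀ t, HasDerivAt (fun t => ∫ s in (0 : ℝ)..t, c s) (c t) t := fun t =>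
    intervalIntegral.integral_hasDerivAt_right (hc.intervalIntegrable _ _)
      hc.aestronglyMeasurable.stronglyMeasurableAtFilter hc.continuousAt
  have hX1 : ContDiff ℝ 1 fun t => ∫ s in (0 : ℝ)..t, c s := by
    rw [contDiff_one_iff_deriv]
    refine ⟨fun t => (hX t).differentiableAt, ?_⟩
    rwa [funext fun t => (hX t).deriv]
  have hac : AbsolutelyContinuousOnInterval (x - fun t => ∫ s in (0 : ℝ)..t, c s) 0 T :=
    (LipschitzOnWith.absolutelyContinuousOnInterval (by rwa [uIcc_of_le hT.le])).sub
      hX1.contDiffOn.absolutelyContinuousOnInterval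
  obtain ⟨C, hC⟩ := hac.const_of_ae_hasDerivAt_zero (by
    filter_upwards [hd, compl_mem_ae_iff.2 (measure_singleton (0 : ℝ)),
      compl_mem_ae_iff.2 (measure_singleton T)] with t h1 h2 h3 ht
    rw [uIcc_of_le hT.le] at ht
    have h4 := (h1 ⟨lt_of_le_of_ne ht.1 (Ne.symm h2), lt_of_le_of_ne ht.2 h3⟩).sub (hX t)
    rwa [sub_self] at h4)
  rw [uIcc_of_le hT.le] at hC
  intro t ht
  have h1 := hC 0 ⟨le_rfl, hT.le⟩
  have h2 := hC t ht
  simp only [Pi.sub_apply, intervalIntegral.integral_same, sub_zero] at h1 h2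
  rw [h1, ← h2]
  abel

/-- The position component of the limit satisfies `ẋ = v - β∇f(x)` only almost everywhere, but the
right side is continuous, so the component coincides with its `C¹` primitive. The velocity is then
this right side at every time, and it inherits Lipschitz continuity from `z`. -/
theorem exists_isStrongGlobalSolution {f φ : H → ℝ} {p : H → H} {β : ℝ} (hf : ContDiff ℝ 2 f)
    (hφ : Continuous φ) (hp : ∀ v, p v ∈ subdifferential φ v)
    (hd : PhaseData f (gradient f) p β) (x₀ x₁ : H) :
    ∃ x : ℝ → H, IsStrongGlobalSolution f φ β x ∧ x 0 = x₀ ∧ velocity x 0 = x₁ := by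
  have hg1 := contDiff_gradient hf
  have hgc := hg1.continuous
  obtain ⟨z, hz⟩ := exists_isEulerLimit
    fun T hT => hd.exists_eulerBound (WithLp.toLp 2 (x₀, x₁ + β • gradient f x₀)) (T := T) hT
  have hz0 := hz.apply_zero
  have hfc : Continuous fun t => (z t).fst := (WithLp.fstL 2 ℝ H H).continuous.comp hz.continuous
  have hsc : Continuous fun t => (z t).snd := (WithLp.sndL 2 ℝ H H).continuous.comp hz.continuous
  set c : ℝ → H := fun t => (z t).snd - β • gradient f (z t).fst with hc
  have hcc : Continuous c := by fun_prop
  have hae : ∀ᵐ t, 0 < t → ∃ z', HasDerivAt z z' t ∧ z'.fst = c t ∧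
      -z'.snd - gradient f (z t).fst ∈ subdifferential φ (z t).snd := by
    filter_upwards [hz.ae_differentiableAt] with t ht ht0
    exact ⟨_, (ht ht0).hasDerivAt,
      deriv_of_isEulerLimit_phaseField hφ hgc hp hz ht0.le (ht ht0).hasDerivAt⟩
  set x : ℝ → H := fun t => x₀ + ∫ s in (0 : ℝ)..t, c s with hx
  have hxd : ∀ t, HasDerivAt x (c t) t := fun t =>
    (intervalIntegral.integral_hasDerivAt_right (hcc.intervalIntegrable _ _)
      hcc.aestronglyMeasurable.stronglyMeasurableAtFilter hcc.continuousAt).const_add _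
  have hxz : ∀ t, 0 ≤ t → (z t).fst = x t := by
    intro t ht
    have hT : 0 < t + 1 := by linarith
    obtain ⟨K, hK⟩ := hz.exists_lipschitzOnWith hT
    have h1 := eq_integral_of_ae_hasDerivAt hT (lipschitzOnWith_fst hK) hcc (by
      filter_upwards [hae] with s hs hs0
      obtain ⟨z', h1, h2, -⟩ := hs hs0.1
      rw [← h2]
      exact hasDerivAt_fst h1) t ⟨ht, by linarith⟩
    rw [h1, hz0]
    rfl
  have hvel : ∀ t, 0 ≤ t → velocity x t = c t := fun t ht =>
    (hxd t).hasDerivWithinAt.derivWithin (uniqueDiffOn_Ici 0 t ht)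
  have hlip : ∀ T : ℝ, 0 < T → ∃ K : ℝ≥0, LipschitzOnWith K (velocity x) (Ioo 0 T) := by
    intro T hT
    obtain ⟨K, hK⟩ := hz.exists_lipschitzOnWith hT
    obtain ⟨L, hL⟩ := hd.lipschitz ((fun t => (z t).fst) '' Icc 0 T)
      (isCompact_Icc.image hfc).isBounded
    have h1 : LipschitzOnWith (L * K) (fun t => gradient f (z t).fst) (Icc 0 T) :=
      hL.comp (lipschitzOnWith_fst hK) (mapsTo_image _ _)
    have h2 : LipschitzOnWith (K + ‖β‖₊ * (L * K)) c (Icc 0 T) :=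
      (lipschitzOnWith_snd hK).sub ((lipschitzWith_smul β).comp_lipschitzOnWith h1)
    refine ⟨K + ‖β‖₊ * (L * K), fun s hs t ht => ?_⟩
    rw [hvel s hs.1.le, hvel t ht.1.le]
    exact h2 (Ioo_subset_Icc_self hs) (Ioo_subset_Icc_self ht)
  refine ⟨x, ⟨?_, hlip, ?_, ?_⟩, by simp [hx], ?_⟩
  · refine ContDiff.contDiffOn (contDiff_one_iff_deriv.2 ⟨fun t => (hxd t).differentiableAt, ?_⟩)
    rwa [funext fun t => (hxd t).deriv]
  · intro T hT
    obtain ⟨K, hK⟩ := hlip T hT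
    refine memLp_top_of_bound (aestronglyMeasurable_deriv _ _) K ?_
    filter_upwards [ae_restrict_mem measurableSet_Ioo] with t ht
    exact norm_deriv_le_of_lipschitzOn (Ioo_mem_nhds ht.1 ht.2) hK
  · rw [ae_restrict_iff' measurableSet_Ioi]
    filter_upwards [hae] with t ht ht0
    obtain ⟨z', h1, h2, h3⟩ := ht ht0
    have hzt := hxz t (le_of_lt ht0)
    have h4 : HasDerivAt (fun s => gradient f (x s)) (hessian f (x t) (c t)) t :=
      ((hg1.differentiable one_ne_zero) (x t)).hasFDerivAt.comp_hasDerivAt t (hxd t)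
    have h5 : HasDerivAt (velocity x) (z'.snd - β • hessian f (x t) (c t)) t := by
      refine ((hasDerivAt_snd h1).sub (h4.const_smul β)).congr_of_eventuallyEq ?_
      filter_upwards [Ioi_mem_nhds ht0] with s hs
      have hs' : 0 ≤ s := le_of_lt hs
      rw [hvel s hs', hc]
      simp only [Pi.sub_apply, Pi.smul_apply, hxz s hs']
    refine ⟨h5.differentiableAt, -z'.snd - gradient f (x t), ?_, ?_⟩
    · rw [hvel t (le_of_lt ht0), hc]
      simp only [← hzt, sub_add_cancel]
      exact h3
    · rw [acceleration, h5.deriv, hvel t (le_of_lt ht0)]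
      abel
  · rw [hvel 0 le_rfl, hc]
    simp only [hz0]
    exact add_sub_cancel_right _ _

end Existence

/-! ### Uniqueness by Grönwall. -/

section Uniqueness

open Filter

/-- Grönwall's inequality for a Lipschitz function satisfying a linear differential inequality
almost everywhere. -/
theorem nonpos_of_ae_deriv_le_mul {D : ℝ → ℝ} {C : ℝ≥0} {K T : ℝ}
    (hD : LipschitzOnWith C D (Icc 0 T)) (h0 : D 0 = 0)
    (hd : ∀ᵐ t, t ∈ Ioo 0 T → ∃ d, HasDerivAt D d t ∧ d ≤ K * D t) {t : ℝ} (ht : t ∈ Icc 0 T) :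
    D t ≤ 0 := by
  -- Multiplying by the integrating factor preserves absolute continuity, so the product is the
  -- integral of its almost everywhere nonpositive derivative.
  have hac : AbsolutelyContinuousOnInterval ((fun s => Real.exp (-K * s)) * D) 0 t := by
    refine AbsolutelyContinuousOnInterval.mul ?_ ?_
    · have : ContDiff ℝ 1 fun s => Real.exp (-K * s) := by fun_prop
      exact this.contDiffOn.absolutelyContinuousOnInterval
    · refine LipschitzOnWith.absolutelyContinuousOnInterval (K := C) ?_
      rw [uIcc_of_le ht.1]
      exact hD.mono (Icc_subset_Icc_right ht.2)
  have h1 := hac.integral_deriv_eq_sub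
  simp only [Pi.mul_apply, h0, mul_zero, sub_zero] at h1
  have h2 : 0 ≤ ∫ s in (0 : ℝ)..t, -deriv ((fun s => Real.exp (-K * s)) * D) s := by
    refine intervalIntegral.integral_nonneg_of_ae_restrict ht.1 ?_
    rw [EventuallyLE, ae_restrict_iff' measurableSet_Icc]
    filter_upwards [hd, compl_mem_ae_iff.2 (measure_singleton (0 : ℝ)),
      compl_mem_ae_iff.2 (measure_singleton t)] with s h3 h4 h5 hs
    obtain ⟨d, h6, h7⟩ := h3 ⟨lt_of_le_of_ne hs.1 (Ne.symm h4),
      (lt_of_le_of_ne hs.2 h5).trans_le ht.2⟩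
    have h8 : HasDerivAt (fun s => Real.exp (-K * s)) (Real.exp (-K * s) * -K) s := by
      simpa using ((hasDerivAt_id s).const_mul (-K)).exp
    rw [(h8.mul h6).deriv, Pi.zero_apply]
    nlinarith [Real.exp_pos (-K * s)]
  rw [intervalIntegral.integral_neg, h1] at h2
  nlinarith [Real.exp_pos (-K * t)]

variable {H : Type*} [NormedAddCommGroup H]

theorem exists_lipschitzOnWith_norm_sq {u : ℝ → H} {K : ℝ≥0} {T : ℝ}
    (hu : LipschitzOnWith K u (Icc 0 T)) :
    ∃ C : ℝ≥0, LipschitzOnWith C (fun t => ‖u t‖ ^ 2) (Icc 0 T) := by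
  obtain ⟨R, hR⟩ := isCompact_Icc.exists_bound_of_continuousOn hu.continuousOn
  refine ⟨2 * R.toNNReal * K, LipschitzOnWith.of_dist_le_mul fun s hs t ht => ?_⟩
  have hR0 : 0 ≤ R := (norm_nonneg _).trans (hR s hs)
  have h1 := hu.norm_sub_le hs ht
  have h2 := abs_norm_sub_norm_le (u s) (u t)
  push_cast
  rw [Real.coe_toNNReal _ hR0, Real.dist_eq, Real.dist_eq, sq_sub_sq, abs_mul,
    abs_of_nonneg (by positivity), mul_assoc]
  refine mul_le_mul ?_ (h2.trans h1) (abs_nonneg _) (by positivity)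
  linarith [hR s hs, hR t ht]

variable [InnerProductSpace ℝ H] [CompleteSpace H]

namespace IsStrongGlobalSolution

variable {f φ : H → ℝ} {β : ℝ} {x y : ℝ → H}

theorem continuousOn_velocity (hx : IsStrongGlobalSolution f φ β x) :
    ContinuousOn (velocity x) (Ici 0) :=
  hx.contDiffOn.continuousOn_derivWithin (uniqueDiffOn_Ici 0) le_rfl

theorem hasDerivWithinAt (hx : IsStrongGlobalSolution f φ β x) {t : ℝ} (ht : 0 ≤ t) :
    HasDerivWithinAt x (velocity x t) (Ici 0) t :=
  (hx.contDiffOn.differentiableOn one_ne_zero t ht).hasDerivWithinAt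

theorem hasDerivAt (hx : IsStrongGlobalSolution f φ β x) {t : ℝ} (ht : 0 < t) :
    HasDerivAt x (velocity x t) t :=
  (hx.hasDerivWithinAt ht.le).hasDerivAt (Ici_mem_nhds ht)

theorem exists_lipschitzOnWith (hx : IsStrongGlobalSolution f φ β x) (T : ℝ) :
    ∃ K : ℝ≥0, LipschitzOnWith K x (Icc 0 T) := by
  obtain ⟨R, hR⟩ := (isCompact_Icc (a := 0) (b := T)).exists_bound_of_continuousOn
    (hx.continuousOn_velocity.mono Icc_subset_Ici_self)
  refine ⟨R.toNNReal, (convex_Icc 0 T).lipschitzOnWith_of_nnnorm_hasDerivWithin_le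
    (fun t ht => (hx.hasDerivWithinAt ht.1).mono Icc_subset_Ici_self) fun t ht => ?_⟩
  rw [← NNReal.coe_le_coe, coe_nnnorm]
  exact (hR t ht).trans (Real.le_coe_toNNReal R)

/-- The definition gives the bound on the open interval; continuity of the velocity carries it to
the closure, in particular to time `0`, where the Cauchy data live. -/
theorem exists_lipschitzOnWith_velocity (hx : IsStrongGlobalSolution f φ β x) {T : ℝ}
    (hT : 0 < T) : ∃ K : ℝ≥0, LipschitzOnWith K (velocity x) (Icc 0 T) := by
  obtain ⟨K, hK⟩ := hx.lipschitz_velocity T hT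
  rw [← closure_Ioo hT.ne]
  refine ⟨K, hK.closure ?_⟩
  rw [closure_Ioo hT.ne]
  exact hx.continuousOn_velocity.mono Icc_subset_Ici_self

theorem exists_lipschitzOnWith_velocity_add (hx : IsStrongGlobalSolution f φ β x)
    (hg : LipschitzOnBounded (gradient f)) {T : ℝ} (hT : 0 < T) :
    ∃ K : ℝ≥0, LipschitzOnWith K (fun t => velocity x t + β • gradient f (x t)) (Icc 0 T) := by
  obtain ⟨K₁, hK₁⟩ := hx.exists_lipschitzOnWith T
  obtain ⟨K₂, hK₂⟩ := hx.exists_lipschitzOnWith_velocity hT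
  obtain ⟨L, hL⟩ := hg (x '' Icc 0 T) (isCompact_Icc.image_of_continuousOn
    hK₁.continuousOn).isBounded
  exact ⟨_, hK₂.add ((lipschitzWith_smul β).comp_lipschitzOnWith
    (hL.comp hK₁ (mapsTo_image _ _)))⟩

/-- The order reduction: by the chain rule the Hessian term is the derivative of `β∇f(x(t))`. -/
theorem ae_hasDerivAt_velocity_add (hx : IsStrongGlobalSolution f φ β x) (hf : ContDiff ℝ 2 f) :
    ∀ᵐ t, 0 < t → ∃ p ∈ subdifferential φ (velocity x t + β • gradient f (x t)),
      HasDerivAt (fun t => velocity x t + β • gradient f (x t)) (-p - gradient f (x t)) t := by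
  have h := hx.inclusion
  rw [ae_restrict_iff' measurableSet_Ioi] at h
  filter_upwards [h] with t ht ht0
  obtain ⟨h1, p, hp, h2⟩ := ht ht0
  refine ⟨p, hp, ?_⟩
  have h3 : HasDerivAt (fun s => gradient f (x s)) (hessian f (x t) (velocity x t)) t :=
    (((contDiff_gradient hf).differentiable one_ne_zero) (x t)).hasFDerivAt.comp_hasDerivAt t
      (hx.hasDerivAt ht0)
  have h4 : -p - gradient f (x t) = acceleration x t + β • hessian f (x t) (velocity x t) := by
    rw [← sub_eq_zero, ← neg_eq_zero, ← h2]
    abel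
  rw [h4]
  exact h1.hasDerivAt.add (h3.const_smul β)

/-- Strong global solutions are determined by their Cauchy data. -/
theorem eqOn (hx : IsStrongGlobalSolution f φ β x) (hy : IsStrongGlobalSolution f φ β y)
    (hf : ContDiff ℝ 2 f) (hg : LipschitzOnBounded (gradient f)) (hβ : 0 ≤ β) (h0 : x 0 = y 0)
    (h1 : velocity x 0 = velocity y 0) : EqOn x y (Ici 0) := by
  intro T hT0
  rcases (mem_Ici.1 hT0).eq_or_lt with rfl | hT
  · exact h0
  obtain ⟨Cx, hCx⟩ := hx.exists_lipschitzOnWith T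
  obtain ⟨Cy, hCy⟩ := hy.exists_lipschitzOnWith T
  obtain ⟨Cv, hCv⟩ := hx.exists_lipschitzOnWith_velocity_add hg hT
  obtain ⟨Cw, hCw⟩ := hy.exists_lipschitzOnWith_velocity_add hg hT
  obtain ⟨L, hL⟩ := hg (x '' Icc 0 T ∪ y '' Icc 0 T)
    ((isCompact_Icc.image_of_continuousOn hCx.continuousOn).isBounded.union
      (isCompact_Icc.image_of_continuousOn hCy.continuousOn).isBounded)
  obtain ⟨C₁, hC₁⟩ := exists_lipschitzOnWith_norm_sq (hCx.sub hCy)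
  obtain ⟨C₂, hC₂⟩ := exists_lipschitzOnWith_norm_sq (hCv.sub hCw)
  set v : ℝ → H := fun t => velocity x t + β • gradient f (x t) with hv
  set w : ℝ → H := fun t => velocity y t + β • gradient f (y t) with hw
  -- The rate is twice the constant of `inner_phase_le`, the factor `2` coming from differentiating
  -- squared norms.
  have key := nonpos_of_ae_deriv_le_mul (D := fun t => ‖x t - y t‖ ^ 2 + ‖v t - w t‖ ^ 2)
    (K := 2 * (1 + L + β * L)) (hC₁.add hC₂) (by simp [hv, hw, h0, h1]) (by
      filter_upwards [hx.ae_hasDerivAt_velocity_add hf, hy.ae_hasDerivAt_velocity_add hf]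
        with t htx hty ht
      obtain ⟨p, hp, hvd⟩ := htx ht.1
      obtain ⟨q, hq, hwd⟩ := hty ht.1
      refine ⟨_, ((hx.hasDerivAt ht.1).sub (hy.hasDerivAt ht.1)).norm_sq.add
        (hvd.sub hwd).norm_sq, ?_⟩
      have ht' := Ioo_subset_Icc_self ht
      have h2 := hL.norm_sub_le (mem_union_left _ (mem_image_of_mem x ht'))
        (mem_union_right _ (mem_image_of_mem y ht'))
      have h3 := inner_phase_le hβ L.coe_nonneg (dv := v t - w t) h2
        (inner_sub_nonneg_of_mem_subdifferential hp hq)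
      have h4 : velocity x t - velocity y t =
          v t - w t - β • (gradient f (x t) - gradient f (y t)) := by
        simp only [hv, hw, smul_sub]
        abel
      have h5 : -p - gradient f (x t) - (-q - gradient f (y t)) =
          -(p - q) - (gradient f (x t) - gradient f (y t)) := by abel
      rw [h4, h5, real_inner_comm, Pi.sub_apply, Pi.sub_apply, real_inner_comm _ (v t - w t)]
      linarith) (t := T) ⟨hT.le, le_rfl⟩
  have h2 : ‖x T - y T‖ ^ 2 ≤ 0 := by
    have := sq_nonneg ‖v T - w T‖
    linarith
  exact sub_eq_zero.1 (norm_eq_zero.1 (pow_eq_zero_iff two_ne_zero |>.1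
    (le_antisymm h2 (sq_nonneg _))))

end IsStrongGlobalSolution
end Uniqueness

end ADIGE

theorem mainTheorem10 {H : Type*} [NormedAddCommGroup H] [InnerProductSpace ℝ H]
    [CompleteSpace H] (f : H → ℝ) (hf_convex : ConvexOn ℝ Set.univ f) (hf_C2 : ContDiff ℝ 2 f)
    (hf_bdd : BddBelow (Set.range f)) (hf_lip : ADIGE.LipschitzOnBounded (gradient f))
    (φ : H → ℝ) (hφ : ADIGE.IsDampingPotential φ) (β : ℝ) (hβ : 0 ≤ β) (x₀ x₁ : H) :
    ∃ x : ℝ → H,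
      (ADIGE.IsStrongGlobalSolution f φ β x ∧ x 0 = x₀ ∧ ADIGE.velocity x 0 = x₁) ∧
      ∀ y : ℝ → H,
        (ADIGE.IsStrongGlobalSolution f φ β y ∧ y 0 = x₀ ∧ ADIGE.velocity y 0 = x₁) →
        Set.EqOn y x (Set.Ici 0) := by
  obtain ⟨p, hp, hd⟩ := ADIGE.exists_phaseData hf_convex hf_C2 hf_bdd hf_lip hφ hβ
  obtain ⟨x, hx, hx₀, hx₁⟩ :=
    ADIGE.exists_isStrongGlobalSolution hf_C2 hφ.continuous hp hd x₀ x₁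
  exact ⟨x, ⟨hx, hx₀, hx₁⟩, fun y ⟨hy, hy₀, hy₁⟩ =>
    hy.eqOn hx hf_C2 hf_lip hβ (hy₀.trans hx₀.symm) (hy₁.trans hx₁.symm)⟩
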